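/- Let $\mathbb R^5_2$ be $\mathbb R^5$ with the scalar product $\langle x,y\rangle=-x_1y_1-x_2y_2+x_3y_3+x_4y_4+x_5y_5$, let $\mathbf H^4_1=\{x\in\mathbb R^5_2:\langle x,x\rangle=-1\}$ be the pseudohyperbolic space with the induced Lorentzian metric, oriented so that a basis $(v_1,\dots,v_4)$ of $T_x\mathbf H^4_1$ is positive iff $\det(x,v_1,\dots,v_4)>0$, and let $\mathbf H^2=\{y\in\mathbb R^3: y_1>0,\ -y_1^2+y_2^2+y_3^2=-1\}$ be the hyperbolic plane with the metric induced by $-dy_1^2+dy_2^2+dy_3^2$. Let $(N,h)$ be an oriented 2-dimensional smooth Riemannian manifold and $f:N\to\mathbf H^4_1$ a smooth isometric immersion. A Darboux frame at $p\in N$ is a positively oriented pseudo-orthonormal basis $(e_1,e_2,e_3,e_4)$ of $T_{f(p)}\mathbf H^4_1$ with $\langle e_1,e_1\rangle=-1$ such that $(e_3,e_4)$ is the image under $df$ of a positively oriented basis of $T_pN$; the line $\mathbb R(e_1+e_2)$, which does not depend on the frame, is the positively oriented normal null direction at $p$. The immersion (surface) is called +isotropic if its second fundamental form $II(X,Y)$,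 the normal part of $\nabla_XY$ with $\nabla$ the Levi-Civita connection of $\mathbf H^4_1$, takes values in the positively oriented normal null directions. Suppose that $f$ is +isotropic. Then: 1. If $N$ is connected and $(N,h)$ is complete, then $(N,h)$ is isometric to $\mathbf H^2$. 2. For every connected component $N_0$ of $N$ there is an isometry $A$ of $\mathbf H^4_1$ (the restriction of a linear isometry of $\mathbb R^5_2$) such that every $p\in N_0$ has an open neighbourhood $U$ in $N$, a diffeomorphism $\psi$ of $U$ onto an open subset of $\mathbf H^2$ and a smooth function $\lambda:\mathbf H^2\to\mathbb R$ with $$f(q)=A\big(i_\lambda(\psi(q))\big)\quad(q\in U),\qquad i_\lambda:\mathbf H^2\to\mathbf H^4_1,\quad i_\lambda(y_1,y_2,y_3)=(y_1,\lambda,\lambda,y_2,y_3),$$ where $\lambda$ stands for $\lambda(y_1,y_2,y_3)$. -/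

import Mathlib

open Set Topology Manifold Bundle
open scoped ContDiff InnerProductSpace

namespace PseudoHyp

/-! ### The pseudo-Euclidean space `ℝ⁵₂` and the pseudohyperbolic space -/

/-- The vector space underlying `ℝ⁵₂`. -/
abbrev R5 : Type := Fin 5 → ℝ

/-- The scalar product of `ℝ⁵₂`, of signature `(-,-,+,+,+)`. -/
def form52 (x y : R5) : ℝ :=
  -(x 0 * y 0) - x 1 * y 1 + x 2 * y 2 + x 3 * y 3 + x 4 * y 4

/-- The scalar product of `ℝ⁵₂` with a fixed vector `x`, as a continuous linear functional. -/
noncomputable def form52L (x : R5) : R5 →L[ℝ] ℝ :=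
  LinearMap.toContinuousLinearMap
    { toFun := fun y => form52 x y
      map_add' := fun y z => by simp only [form52, Pi.add_apply]; ring
      map_smul' := fun c y => by
        simp only [form52, Pi.smul_apply, smul_eq_mul, RingHom.id_apply]; ring }

@[simp] theorem form52L_apply (x y : R5) : form52L x y = form52 x y := rfl

/-- The pseudohyperbolic space `H⁴₁`, a hypersurface of `ℝ⁵₂`.  Its tangent space at `x` is
`{v | form52 x v = 0}`, with the induced Lorentzian metric. -/
def H41 : Set R5 := {x | form52 x x = -1}

/-- Linear isometries of `ℝ⁵₂`.  Their restrictions to `H41` are the isometries of `H⁴₁`. -/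
def IsLinearIsometry52 (A : R5 ≃ₗ[ℝ] R5) : Prop :=
  ∀ x y : R5, form52 (A x) (A y) = form52 x y

/-! ### The hyperbolic plane -/

/-- The scalar product of `ℝ³₁`, of signature `(-,+,+)`. -/
def form31 (x y : Fin 3 → ℝ) : ℝ := -(x 0 * y 0) + x 1 * y 1 + x 2 * y 2

/-- The hyperbolic plane, as a sheet of the hyperboloid in `ℝ³₁`. -/
def Hyp2 : Type := {y : Fin 3 → ℝ // 0 < y 0 ∧ form31 y y = -1}

namespace Hyp2

/-- The inclusion of the hyperbolic plane into `ℝ³₁`. -/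
def toVec (y : Hyp2) : Fin 3 → ℝ := y.1

instance : TopologicalSpace Hyp2 := instTopologicalSpaceSubtype

/-- The point of the hyperboloid above `(u 0, u 1)`. -/
noncomputable def lift (u : EuclideanSpace ℝ (Fin 2)) : Fin 3 → ℝ :=
  ![Real.sqrt (1 + u 0 ^ 2 + u 1 ^ 2), u 0, u 1]

theorem lift_mem (u : EuclideanSpace ℝ (Fin 2)) :
    0 < lift u 0 ∧ form31 (lift u) (lift u) = -1 := by
  have h : (0 : ℝ) < 1 + u 0 ^ 2 + u 1 ^ 2 := by positivity
  have h2 := Real.mul_self_sqrt h.le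
  refine ⟨Real.sqrt_pos.2 h, ?_⟩
  simp only [form31, lift, Matrix.cons_val]
  linarith

theorem contDiff_lift : ContDiff ℝ ∞ lift := by
  rw [contDiff_pi]
  intro i
  fin_cases i
  · refine ContDiff.sqrt (by fun_prop) (fun u => ?_)
    positivity
  · show ContDiff ℝ ∞ (fun u : EuclideanSpace ℝ (Fin 2) => u 0)
    fun_prop
  · show ContDiff ℝ ∞ (fun u : EuclideanSpace ℝ (Fin 2) => u 1)
    fun_prop

/-- The vertical projection of the hyperboloid onto the plane: a global chart. -/
noncomputable def chart : Hyp2 ≃ₜ EuclideanSpace ℝ (Fin 2) where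
  toFun y := !₂[toVec y 1, toVec y 2]
  invFun u := ⟨lift u, lift_mem u⟩
  left_inv y := by
    obtain ⟨y, hy0, hy⟩ := y
    refine Subtype.ext (funext fun i => ?_)
    fin_cases i
    · have h : 1 + y 1 ^ 2 + y 2 ^ 2 = y 0 ^ 2 := by
        simp only [form31] at hy; linarith
      simp [lift, toVec, h, Real.sqrt_sq hy0.le]
    · simp [lift, toVec]
    · simp [lift, toVec]
  right_inv u := by
    ext i
    fin_cases i <;> simp [toVec, lift]
  continuous_toFun := by
    have h : Continuous toVec := continuous_subtype_val
    fun_prop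
  continuous_invFun := contDiff_lift.continuous.subtype_mk _

noncomputable instance : ChartedSpace (EuclideanSpace ℝ (Fin 2)) Hyp2 :=
  chart.toOpenPartialHomeomorph.singletonChartedSpace rfl

instance : IsManifold (𝓡 2) ∞ Hyp2 :=
  chart.toOpenPartialHomeomorph.isManifold_singleton rfl

/-- The inclusion of the hyperbolic plane is smooth. -/
theorem contMDiff_toVec : ContMDiff (𝓡 2) 𝓘(ℝ, Fin 3 → ℝ) ∞ toVec := by
  intro y
  rw [contMDiffAt_iff]
  refine ⟨(continuous_subtype_val : Continuous toVec).continuousAt, ?_⟩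
  exact contDiff_lift.contDiffAt.contDiffWithinAt

end Hyp2

/-! ### Oriented spacelike surfaces in the pseudohyperbolic space -/

section Surfaces

variable {N : Type*} [TopologicalSpace N] [ChartedSpace (EuclideanSpace ℝ (Fin 2)) N]

/-- A vector field on `N` which is smooth at (hence near) the point `p`. -/
def SmoothFieldAt (Y : ∀ q : N, TangentSpace (𝓡 2) q) (p : N) [IsManifold (𝓡 2) ∞ N] : Prop :=
  ContMDiffAt (𝓡 2) (𝓡 2).tangent ∞ (fun q => (⟨q, Y q⟩ : TangentBundle (𝓡 2) N)) p

/-- A pointwise choice of orientations of the tangent planes is an orientation of the surface `N`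
if every point is in the domain of a positively oriented smooth local frame. -/
def IsSurfaceOrientation [IsManifold (𝓡 2) ∞ N]
    (o : ∀ p : N, Orientation ℝ (TangentSpace (𝓡 2) p) (Fin 2)) : Prop :=
  ∀ p : N, ∃ U : Set N, IsOpen U ∧ p ∈ U ∧ ∃ X Y : ∀ q : N, TangentSpace (𝓡 2) q,
    ∀ q ∈ U, SmoothFieldAt X q ∧ SmoothFieldAt Y q ∧
      ∃ b : Module.Basis (Fin 2) ℝ (TangentSpace (𝓡 2) q),
        b 0 = X q ∧ b 1 = Y q ∧ b.orientation = o q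

/-- The differential of `f : N → ℝ⁵₂`. -/
noncomputable def dmap (f : N → R5) (p : N) : TangentSpace (𝓡 2) p →L[ℝ] R5 :=
  mfderiv (𝓡 2) 𝓘(ℝ, R5) f p

/-- A Darboux frame `(e₁, e₂, e₃, e₄)` (here `e 0, …, e 3`) of `H⁴₁` along `f` at `p`: a positively
oriented pseudo-orthonormal basis of the tangent space of `H⁴₁` at `f p`, with `e₁` timelike,
such that `(e₃, e₄)` is a positively oriented basis of the image of the tangent plane of `N`.
A basis of the tangent space of `H⁴₁` at `x` is positively oriented if, with `x` put in front,
it is a positively oriented basis of `ℝ⁵`. -/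
structure IsDarbouxFrame (f : N → R5)
    (o : ∀ p : N, Orientation ℝ (TangentSpace (𝓡 2) p) (Fin 2)) (p : N)
    (e : Fin 4 → R5) : Prop where
  tangent : ∀ i, form52 (f p) (e i) = 0
  orthonormal : ∀ i j, form52 (e i) (e j) = if i = j then (if i = 0 then -1 else 1) else 0
  positive : 0 < Matrix.det (Matrix.of ![f p, e 0, e 1, e 2, e 3])
  adapted : ∃ b : Module.Basis (Fin 2) ℝ (TangentSpace (𝓡 2) p),
    b.orientation = o p ∧ dmap f p (b 0) = e 2 ∧ dmap f p (b 1) = e 3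

/-- The fibre at `p` of the bundle of positively oriented normal null directions: the line
`ℝ (e₁ + e₂)`, for any Darboux frame at `p`. -/
def plusNullLine (f : N → R5)
    (o : ∀ p : N, Orientation ℝ (TangentSpace (𝓡 2) p) (Fin 2)) (p : N) : Submodule ℝ R5 :=
  Submodule.span ℝ {ν | ∃ e, IsDarbouxFrame f o p e ∧ ν = e 0 + e 1}

variable [RiemannianBundle (fun p : N => TangentSpace (𝓡 2) p)]

/-- `f` is a smooth isometric immersion of the Riemannian surface `N` into `H⁴₁`. -/
structure IsIsometricImmersion (f : N → R5) : Prop where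
  smooth : ContMDiff (𝓡 2) 𝓘(ℝ, R5) ∞ f
  mem : ∀ p, f p ∈ H41
  isometric : ∀ (p : N) (v w : TangentSpace (𝓡 2) p),
    form52 (dmap f p v) (dmap f p w) = ⟪v, w⟫_ℝ

/-- The covariant derivative at `p`, in direction `v`, of the vector field `df(Y)` along `f`, for
the Levi-Civita connection of `H⁴₁`: the flat derivative in `ℝ⁵₂`, projected orthogonally to the
tangent space of `H⁴₁` at `f p`. -/
noncomputable def covDeriv (f : N → R5) (p : N) (v : TangentSpace (𝓡 2) p)
    (Y : ∀ q : N, TangentSpace (𝓡 2) q) : R5 :=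
  let D : R5 := (mfderiv (𝓡 2) 𝓘(ℝ, R5) (fun q => dmap f q (Y q)) p : _ →L[ℝ] R5) v
  D + form52 D (f p) • f p

/-- The tangent vector `t` of `N` at `p` such that `df(t)` is the component of `w` tangent to the
surface: it is determined by `⟪t, v⟫ = form52 w (df v)` for all `v`. -/
noncomputable def tangentPart (f : N → R5) (p : N) (w : R5) : TangentSpace (𝓡 2) p :=
  haveI : FiniteDimensional ℝ (TangentSpace (𝓡 2) p) :=
    inferInstanceAs (FiniteDimensional ℝ (EuclideanSpace ℝ (Fin 2)))
  haveI : CompleteSpace (TangentSpace (𝓡 2) p) := FiniteDimensional.complete ℝ _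
  (InnerProductSpace.toDual ℝ (TangentSpace (𝓡 2) p)).symm ((form52L w).comp (dmap f p))

/-- The second fundamental form `II(X, Y)` of `f` at `p`, where `X p = v`: the component of the
covariant derivative normal to the surface. -/
noncomputable def secondFundamentalForm (f : N → R5) (p : N) (v : TangentSpace (𝓡 2) p)
    (Y : ∀ q : N, TangentSpace (𝓡 2) q) : R5 :=
  covDeriv f p v Y - dmap f p (tangentPart f p (covDeriv f p v Y))

/-- `f` is +isotropic: its second fundamental form takes values in the bundle of positively
oriented normal null directions. -/
def IsPlusIsotropic [IsManifold (𝓡 2) ∞ N] (f : N → R5)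
    (o : ∀ p : N, Orientation ℝ (TangentSpace (𝓡 2) p) (Fin 2)) : Prop :=
  ∀ (p : N) (v : TangentSpace (𝓡 2) p) (Y : ∀ q : N, TangentSpace (𝓡 2) q),
    SmoothFieldAt Y p → secondFundamentalForm f p v Y ∈ plusNullLine f o p

variable (N) in
/-- `N` is isometric to the hyperbolic plane with the metric induced from `ℝ³₁`. -/
def IsometricToHyp2 : Prop :=
  ∃ φ : N ≃ₘ^∞⟮𝓡 2, 𝓡 2⟯ Hyp2, ∀ (p : N) (v w : TangentSpace (𝓡 2) p),
    form31 (mfderiv (𝓡 2) 𝓘(ℝ, Fin 3 → ℝ) (fun q => (φ q).toVec) p v)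
      (mfderiv (𝓡 2) 𝓘(ℝ, Fin 3 → ℝ) (fun q => (φ q).toVec) p w) = ⟪v, w⟫_ℝ

end Surfaces

/-- The map `i_λ : H² → H⁴₁`, `(y₁, y₂, y₃) ↦ (y₁, λ, λ, y₂, y₃)`. -/
def iMap (lam : Hyp2 → ℝ) (y : Hyp2) : R5 :=
  ![y.toVec 0, lam y, lam y, y.toVec 1, y.toVec 2]

end PseudoHyp

open PseudoHyp

namespace PseudoHyp

/-! ### Algebra of `ℝ⁵₂` -/

/-! The positively oriented null line turns out to be parallel in the ambient flat space. Let `ν = e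
0 + e 1` for a smooth local Darboux frame. Differentiating `⟨ν, ν⟩ = 0`, `⟨ν, f⟩ = 0` and `⟨ν, df Z⟩
= 0` shows that `dν` is orthogonal to `ν`, to `f` and to the tangent plane; the last orthogonality
uses that the second fundamental form is a multiple of `ν`, which is null. The common orthogonal
complement of these vectors is `ℝν`, so `dν` is proportional to `ν` and the line `ℝν` is locally
constant (`isLocallyConstant_plusNullLine`). Independence of the frame comes from the map `u ↦ cross
(f p) u (e 2) (e 3)`: it depends only on the oriented tangent plane, exchanges `e 0` and `e 1`, and
so fixes `ν` (`plusNullLine_eq`).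

On a connected component, a linear isometry moves this line to `ℝ(0,1,1,0,0)`. Since `f` and `df`
are orthogonal to it, the second and third coordinates agree and cancel in the scalar product.
Dropping them is therefore isometric, with values in the hyperboloid `-y₁² + y₂² + y₃² = -1`;
connectedness keeps the values on one sheet. The inverse function theorem then writes the surface
locally as the image of `i_λ`, with `λ` the dropped coordinate (`exists_local_form`).

In the complete case, the further projection `u` to the `(y₂, y₃)` plane is a local diffeomorphism
that does not shrink tangent vectors, because it only discards the negative term `-v₁²`. Straight
segments therefore lift from any point: a lift has bounded speed, and completeness supplies its
limit. The lifted segments give a continuous section of `u` with open and closed image, so `u` is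
bijective (`bijective_of_expanding`), and the projection to the hyperbolic plane is a global
isometry. -/

theorem form52_comm (x y : R5) : form52 x y = form52 y x := by
  simp only [form52]; ring

theorem form52_add_left (x y z : R5) : form52 (x + y) z = form52 x z + form52 y z := by
  simp only [form52, Pi.add_apply]; ring

theorem form52_add_right (x y z : R5) : form52 z (x + y) = form52 z x + form52 z y := by
  simp only [form52, Pi.add_apply]; ring

theorem form52_sub_left (x y z : R5) : form52 (x - y) z = form52 x z - form52 y z := by
  simp only [form52, Pi.sub_apply]; ring

theorem form52_sub_right (x y z : R5) : form52 z (x - y) = form52 z x - form52 z y := by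
  simp only [form52, Pi.sub_apply]; ring

theorem form52_smul_left (c : ℝ) (x z : R5) : form52 (c • x) z = c * form52 x z := by
  simp only [form52, Pi.smul_apply, smul_eq_mul]; ring

theorem form52_smul_right (c : ℝ) (x z : R5) : form52 z (c • x) = c * form52 z x := by
  simp only [form52, Pi.smul_apply, smul_eq_mul]; ring

theorem form52_zero_left (z : R5) : form52 0 z = 0 := by simp [form52]

theorem form52_zero_right (z : R5) : form52 z 0 = 0 := by simp [form52]

theorem form52_neg_left (x z : R5) : form52 (-x) z = -form52 x z := by
  simp only [form52, Pi.neg_apply]; ring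

theorem form52_nondegenerate {x : R5} (h : ∀ u, form52 x u = 0) : x = 0 := by
  funext i
  have := h (Pi.single i 1)
  fin_cases i <;> simpa [form52] using this

theorem form52_ext {x y : R5} (h : ∀ u, form52 x u = form52 y u) : x = y :=
  sub_eq_zero.1 (form52_nondegenerate fun u => by rw [form52_sub_left, h u, sub_self])

/-- The determinant of five vectors of `ℝ⁵`. -/
noncomputable def det5 (a b c d e : R5) : ℝ := Matrix.det (n := Fin 5) (Matrix.of ![a, b, c, d, e])

theorem det5_eq_det (a b c d e : R5) :
    det5 a b c d e = Matrix.det (Matrix.of ![a, b, c, d, e]) := rfl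

/-- The Gram matrix of the standard basis of `ℝ⁵₂`. -/
def eta : Matrix (Fin 5) (Fin 5) ℝ := Matrix.diagonal ![-1, -1, 1, 1, 1]

theorem det_eta : eta.det = 1 := by
  simp [eta, Fin.prod_univ_succ]

theorem gram_eq (v w : Fin 5 → R5) (i j : Fin 5) :
    (Matrix.of v * eta * (Matrix.of w).transpose) i j = form52 (v i) (w j) := by
  simp [Matrix.mul_apply, eta, Matrix.diagonal_apply, Fin.sum_univ_succ, form52]
  ring

/-- The Gram matrix is `V η Vᵀ` and `det η = 1`, because the number of negative directions is even.
-/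
theorem det_sq_eq_det_gram (v : Fin 5 → R5) :
    (Matrix.of v).det ^ 2 = (Matrix.of fun i j => form52 (v i) (v j)).det := by
  have : (Matrix.of fun i j => form52 (v i) (v j))
      = Matrix.of v * eta * (Matrix.of v).transpose := by
    ext i j; rw [gram_eq]; rfl
  rw [this, Matrix.det_mul, Matrix.det_mul, det_eta, Matrix.det_transpose]; ring

/-- The vector dual to the linear form `u ↦ det5 a b u c d`. -/
noncomputable def cross (a b c d : R5) : R5 := fun i =>
  ![-1, -1, 1, 1, 1] i * det5 a b (Pi.single i 1) c d

theorem det5_add_mid (a b u v c d : R5) :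
    det5 a b (u + v) c d = det5 a b u c d + det5 a b v c d := by
  have e : ∀ z : R5, (Matrix.of ![a, b, 0, c, d]).updateRow (2 : Fin 5) z
      = Matrix.of ![a, b, z, c, d] := fun z => by
    ext i j; fin_cases i <;> simp [Matrix.updateRow_apply]
  simp only [det5]
  rw [← e (u + v), Matrix.det_updateRow_add, e, e]

theorem det5_smul_mid (a b : R5) (r : ℝ) (u c d : R5) :
    det5 a b (r • u) c d = r * det5 a b u c d := by
  have e : ∀ z : R5, (Matrix.of ![a, b, 0, c, d]).updateRow (2 : Fin 5) z
      = Matrix.of ![a, b, z, c, d] := fun z => by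
    ext i j; fin_cases i <;> simp [Matrix.updateRow_apply]
  simp only [det5]
  rw [← e (r • u), Matrix.det_updateRow_smul, e]

theorem det5_swap (a b u c d : R5) : det5 a u b c d = - det5 a b u c d := by
  have := Matrix.det_permute (Equiv.swap (1 : Fin 5) 2) (Matrix.of ![a, b, u, c, d])
  have e : (Matrix.of ![a, b, u, c, d]).submatrix (Equiv.swap (1 : Fin 5) 2) id
      = Matrix.of ![a, u, b, c, d] := by
    ext i j; fin_cases i <;> simp [Equiv.swap_apply_def]
  rw [e, Equiv.Perm.sign_swap (by decide)] at this
  simpa [det5] using this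

theorem form52_cross (a b c d u : R5) : form52 (cross a b c d) u = det5 a b u c d := by
  have hu : u = ∑ i, u i • (Pi.single i 1 : R5) := by
    funext j; simp [Finset.sum_apply, Pi.single_apply]
  let L : R5 →ₗ[ℝ] ℝ :=
    { toFun := fun u => det5 a b u c d
      map_add' := fun u v => det5_add_mid a b u v c d
      map_smul' := fun r u => det5_smul_mid a b r u c d }
  have h : L u = ∑ i, u i * det5 a b (Pi.single i 1) c d := by
    conv_lhs => rw [hu, map_sum]
    simp only [map_smul]
    rfl
  change _ = L u
  rw [h]
  simp [form52, cross, Fin.sum_univ_succ]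
  ring

theorem cross_add (a b b' c d : R5) : cross a (b + b') c d = cross a b c d + cross a b' c d := by
  refine form52_ext fun u => ?_
  rw [form52_add_left, form52_cross, form52_cross, form52_cross, det5_swap, det5_add_mid,
    det5_swap a b, det5_swap a b']
  ring

theorem det5_eq_zero (v : Fin 5 → R5) {i j : Fin 5} (h : v i = v j) (hij : i ≠ j) :
    det5 (v 0) (v 1) (v 2) (v 3) (v 4) = 0 := by
  have e : ![v 0, v 1, v 2, v 3, v 4] = v := by funext i; fin_cases i <;> rfl
  rw [det5, e]
  exact Matrix.det_zero_of_row_eq hij h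

/-- The last two arguments enter only through their oriented area element; this makes the normal
operator independent of the basis of the tangent plane. -/
theorem cross_rotate (a b c d : R5) (α β γ δ : ℝ) :
    cross a b (α • c + β • d) (γ • c + δ • d) = (α * δ - β * γ) • cross a b c d := by
  refine form52_ext fun u => ?_
  rw [form52_smul_left, form52_cross, form52_cross]
  have key : Matrix.of ![a, b, u, α • c + β • d, γ • c + δ • d]
      = !![1,0,0,0,0;0,1,0,0,0;0,0,1,0,0;0,0,0,α,β;0,0,0,γ,δ] * Matrix.of ![a, b, u, c, d] := by
    ext i j
    fin_cases i <;> simp [Matrix.mul_apply, Fin.sum_univ_succ]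
  rw [det5_eq_det, key, Matrix.det_mul, det5_eq_det]
  congr 1
  simp [Matrix.det_succ_row_zero, Fin.sum_univ_succ]
  ring

/-- Five vectors with the Gram matrix of the standard basis. -/
structure PseudoOrthonormal (x : R5) (e : Fin 4 → R5) : Prop where
  self : form52 x x = -1
  tangent : ∀ i, form52 x (e i) = 0
  orthonormal : ∀ i j, form52 (e i) (e j) = if i = j then (if i = 0 then -1 else 1) else 0

namespace PseudoOrthonormal

theorem tangent' {x : R5} {e : Fin 4 → R5} (h : PseudoOrthonormal x e) (i : Fin 4) :
    form52 (e i) x = 0 := by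
  rw [form52_comm, h.tangent]

theorem det_sq {x : R5} {e : Fin 4 → R5} (h : PseudoOrthonormal x e) :
    det5 x (e 0) (e 1) (e 2) (e 3) ^ 2 = 1 := by
  have := det_sq_eq_det_gram ![x, e 0, e 1, e 2, e 3]
  rw [det5_eq_det, this, ← det_eta]
  congr 1
  ext i j
  fin_cases i <;> fin_cases j <;>
    simp [eta, h.self, h.tangent, h.orthonormal, form52_comm _ x]

theorem eq_zero {x : R5} {e : Fin 4 → R5} (h : PseudoOrthonormal x e) {z : R5}
    (hx : form52 z x = 0) (he : ∀ i, form52 z (e i) = 0) : z = 0 := by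
  have hd : (Matrix.of ![x, e 0, e 1, e 2, e 3]).det ≠ 0 := fun h0 => by
    have := h.det_sq
    rw [det5_eq_det, h0] at this
    norm_num at this
  have : Matrix.mulVec (Matrix.of ![x, e 0, e 1, e 2, e 3]) (eta.mulVec z) = 0 := by
    have key : ∀ y : R5, y ⬝ᵥ eta.mulVec z = form52 z y := fun y => by
      simp [dotProduct, eta, Matrix.mulVec_diagonal, Fin.sum_univ_succ, form52]; ring
    funext i
    fin_cases i <;> simp [Matrix.mulVec, key, hx, he]
  have h1 := Matrix.eq_zero_of_mulVec_eq_zero hd this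
  exact Matrix.eq_zero_of_mulVec_eq_zero (by rw [det_eta]; norm_num) h1

theorem expand {x : R5} {e : Fin 4 → R5} (h : PseudoOrthonormal x e) (z : R5) :
    z = -form52 z x • x - form52 z (e 0) • e 0 + form52 z (e 1) • e 1 + form52 z (e 2) • e 2
      + form52 z (e 3) • e 3 := by
  rw [← sub_eq_zero]
  refine h.eq_zero ?_ fun i => ?_
  · simp [form52_sub_left, form52_add_left, form52_smul_left, form52_neg_left, h.self, h.tangent']
  · fin_cases i <;>
    · simp [form52_sub_left, form52_add_left, form52_smul_left, form52_neg_left,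
        h.orthonormal, h.tangent]

/-- The normal vectors orthogonal to the null vector `e 0 + e 1` are its multiples. -/
theorem mem_span_null {x : R5} {e : Fin 4 → R5} (h : PseudoOrthonormal x e) {z : R5}
    (hx : form52 z x = 0) (h2 : form52 z (e 2) = 0) (h3 : form52 z (e 3) = 0)
    (hn : form52 z (e 0 + e 1) = 0) : z = form52 z (e 1) • (e 0 + e 1) := by
  rw [form52_add_right] at hn
  conv_lhs => rw [h.expand z, hx, h2, h3, eq_neg_of_add_eq_zero_left hn]
  simp only [smul_add, neg_smul, zero_smul, neg_zero]
  abel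

/-- On the normal plane, `b ↦ cross x b (e 2) (e 3)` sends `e 0` to `e 1` and `e 1` to `e 0`. The
orientation thus separates the two null lines: `e 0 + e 1` has eigenvalue `1`, while `e 0 - e 1` has
eigenvalue `-1`. -/
theorem cross_null {x : R5} {e : Fin 4 → R5} (h : PseudoOrthonormal x e)
    (hpos : 0 < det5 x (e 0) (e 1) (e 2) (e 3)) :
    cross x (e 0 + e 1) (e 2) (e 3) = e 0 + e 1 := by
  have hd : det5 x (e 0) (e 1) (e 2) (e 3) = 1 := by nlinarith [h.det_sq]
  rw [← sub_eq_zero]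
  have z : ∀ (v : Fin 5 → R5) (i j : Fin 5), v i = v j → i ≠ j →
    det5 (v 0) (v 1) (v 2) (v 3) (v 4) = 0 := fun v i j a b => det5_eq_zero v a b
  have z1 : ∀ b u, det5 x b u (e 2) (e 3) = -det5 x u b (e 2) (e 3) := fun b u => det5_swap ..
  have hx : ∀ b, form52 (cross x b (e 2) (e 3)) x = 0 := fun b => by
    rw [form52_cross]; exact z ![x, b, x, e 2, e 3] 0 2 rfl (by decide)
  have hb : ∀ b, form52 (cross x b (e 2) (e 3)) b = 0 := fun b => by
    rw [form52_cross]; exact z ![x, b, b, e 2, e 3] 1 2 rfl (by decide)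
  have h2 : ∀ b, form52 (cross x b (e 2) (e 3)) (e 2) = 0 := fun b => by
    rw [form52_cross]; exact z ![x, b, e 2, e 2, e 3] 2 3 rfl (by decide)
  have h3 : ∀ b, form52 (cross x b (e 2) (e 3)) (e 3) = 0 := fun b => by
    rw [form52_cross]; exact z ![x, b, e 3, e 2, e 3] 2 4 rfl (by decide)
  have h01 : form52 (cross x (e 0) (e 2) (e 3)) (e 1) = 1 := by rw [form52_cross, hd]
  have h10 : form52 (cross x (e 1) (e 2) (e 3)) (e 0) = -1 := by rw [form52_cross, z1, hd]
  refine h.eq_zero ?_ fun i => ?_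
  · simp [form52_sub_left, form52_add_left, cross_add, hx, h.tangent']
  · fin_cases i <;>
    · simp [form52_sub_left, form52_add_left, cross_add, h.orthonormal, hb, h2, h3, h01, h10]

end PseudoOrthonormal

/-- A fixed vector of `x ↦ cross x · c d` is orthogonal to every other one. -/
theorem form52_eq_zero_of_cross_eq {x c d z w : R5} (hz : cross x z c d = z)
    (hw : cross x w c d = w) : form52 z w = 0 := by
  have h1 : form52 z w = det5 x z w c d := by rw [← form52_cross, hz]
  have h2 : form52 w z = det5 x w z c d := by rw [← form52_cross, hw]
  rw [det5_swap, ← h1, form52_comm] at h2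
  linarith

theorem form52_cross_self {x b c d : R5} (hx : form52 x x = -1) (hb : form52 b b = -1)
    (hc : form52 c c = 1) (hd : form52 d d = 1) (hxb : form52 x b = 0) (hxc : form52 x c = 0)
    (hxd : form52 x d = 0) (hbc : form52 b c = 0) (hbd : form52 b d = 0) (hcd : form52 c d = 0) :
    form52 (cross x b c d) (cross x b c d) = 1 := by
  -- The left side is the square of a determinant, hence the Gram determinant of `x, b, u, c, d`.
  have key : ∀ u, form52 (cross x b c d) u ^ 2 = form52 u u + form52 u x ^ 2 + form52 u b ^ 2
      - form52 u c ^ 2 - form52 u d ^ 2 := fun u => by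
    rw [form52_cross, det5_eq_det, det_sq_eq_det_gram]
    have : (Matrix.of fun i j => form52 (![x, b, u, c, d] i) (![x, b, u, c, d] j))
      = !![-1, 0, form52 u x, 0, 0; 0, -1, form52 u b, 0, 0;
          form52 u x, form52 u b, form52 u u, form52 u c, form52 u d;
          0, 0, form52 u c, 1, 0; 0, 0, form52 u d, 0, 1] := by
      ext i j
      fin_cases i <;> fin_cases j <;>
        simp [hx, hb, hc, hd, hxb, hxc, hxd, hbc, hbd, hcd, form52_comm _ u, form52_comm b x,
          form52_comm c x, form52_comm d x, form52_comm c b, form52_comm d b, form52_comm d c]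
    rw [this]
    simp [Matrix.det_succ_row_zero, Fin.sum_univ_succ, Fin.succAbove]
    ring
  generalize cross x b c d = n at key ⊢
  -- Summing `key` over the standard basis with the signs of the form gives `⟨n, n⟩` on the left and
  -- `5 + ⟨x, x⟩ + ⟨b, b⟩ - ⟨c, c⟩ - ⟨d, d⟩ = 1` on the right.
  have k0 := key (Pi.single 0 1)
  have k1 := key (Pi.single 1 1)
  have k2 := key (Pi.single 2 1)
  have k3 := key (Pi.single 3 1)
  have k4 := key (Pi.single 4 1)
  simp [form52] at k0 k1 k2 k3 k4
  simp only [form52] at hx hb hc hd ⊢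
  linarith

/-! ### Gram–Schmidt frames -/

/-- The first vector of the Gram–Schmidt basis of the plane spanned by `X` and `Y`. -/
noncomputable def gsFst (X : R5) : R5 := (√(form52 X X))⁻¹ • X

/-- The component of `Y` orthogonal to `X`. -/
noncomputable def gsRest (X Y : R5) : R5 := Y - form52 Y (gsFst X) • gsFst X

/-- The second vector of the Gram–Schmidt basis of the plane spanned by `X` and `Y`. -/
noncomputable def gsSnd (X Y : R5) : R5 := gsFst (gsRest X Y)

/-- A timelike vector orthogonal to the timelike vector `x`. -/
def timelikePerp (x : R5) : R5 := ![-x 1, x 0, 0, 0, 0]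

/-- A timelike vector orthogonal to `x`, `X` and `Y`. -/
noncomputable def timelikeRest (x X Y : R5) : R5 :=
  timelikePerp x - form52 (timelikePerp x) (gsFst X) • gsFst X
    - form52 (timelikePerp x) (gsSnd X Y) • gsSnd X Y

/-- The unit vector in the direction of `timelikeRest`. -/
noncomputable def timelikeUnit (x X Y : R5) : R5 :=
  (√(-form52 (timelikeRest x X Y) (timelikeRest x X Y)))⁻¹ • timelikeRest x X Y

/-- The pseudo-orthonormal frame at `x` adapted to the plane spanned by `X` and `Y`. -/
noncomputable def gsFrame (x X Y : R5) : Fin 4 → R5 :=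
  ![timelikeUnit x X Y, cross x (timelikeUnit x X Y) (gsFst X) (gsSnd X Y), gsFst X, gsSnd X Y]

theorem form52_gsFst_self {X : R5} (hX : 0 < form52 X X) : form52 (gsFst X) (gsFst X) = 1 := by
  rw [gsFst, form52_smul_left, form52_smul_right, ← mul_assoc, ← mul_inv,
    Real.mul_self_sqrt hX.le, inv_mul_cancel₀ hX.ne']

theorem form52_gsFst_eq_zero {x X : R5} (h : form52 x X = 0) : form52 x (gsFst X) = 0 := by
  rw [gsFst, form52_smul_right, h, mul_zero]

theorem form52_gsRest_gsFst {X : R5} (Y : R5) (hX : 0 < form52 X X) :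
    form52 (gsFst X) (gsRest X Y) = 0 := by
  rw [gsRest, form52_sub_right, form52_smul_right, form52_gsFst_self hX, form52_comm Y]
  ring

/-- The square of `timelikePerp x` is `-x₁² - x₂² ≤ -1`, and removing components along orthonormal
spacelike vectors only lowers it. -/
theorem form52_timelikeRest_neg {x X Y : R5} (hx : form52 x x = -1) (hX : 0 < form52 X X)
    (hY : 0 < form52 (gsRest X Y) (gsRest X Y)) :
    form52 (timelikeRest x X Y) (timelikeRest x X Y) < 0 := by
  have h1 := form52_gsFst_self hX
  have h2 : form52 (gsSnd X Y) (gsSnd X Y) = 1 := form52_gsFst_self hY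
  have h12 : form52 (gsFst X) (gsSnd X Y) = 0 := form52_gsFst_eq_zero (form52_gsRest_gsFst Y hX)
  have h21 : form52 (gsSnd X Y) (gsFst X) = 0 := by rw [form52_comm, h12]
  have hw : form52 (timelikePerp x) (timelikePerp x) < 0 := by
    simp only [form52] at hx
    simp [form52, timelikePerp]
    nlinarith [sq_nonneg (x 2), sq_nonneg (x 3), sq_nonneg (x 4)]
  simp only [timelikeRest, form52_sub_left, form52_sub_right, form52_smul_left, form52_smul_right,
    h1, h2, h12, h21, form52_comm _ (timelikePerp x)]
  nlinarith [sq_nonneg (form52 (timelikePerp x) (gsFst X)),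
    sq_nonneg (form52 (timelikePerp x) (gsSnd X Y))]

theorem gsFrame_spec {x X Y : R5} (hx : form52 x x = -1) (hxX : form52 x X = 0)
    (hxY : form52 x Y = 0) (hX : 0 < form52 X X) (hY : 0 < form52 (gsRest X Y) (gsRest X Y)) :
    PseudoOrthonormal x (gsFrame x X Y) ∧
      0 < det5 x (gsFrame x X Y 0) (gsFrame x X Y 1) (gsFrame x X Y 2) (gsFrame x X Y 3) := by
  have h1 := form52_gsFst_self hX
  have h2 : form52 (gsSnd X Y) (gsSnd X Y) = 1 := form52_gsFst_self hY
  have h12 : form52 (gsFst X) (gsSnd X Y) = 0 := form52_gsFst_eq_zero (form52_gsRest_gsFst Y hX)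
  have h21 : form52 (gsSnd X Y) (gsFst X) = 0 := by rw [form52_comm, h12]
  have hx1 : form52 x (gsFst X) = 0 := form52_gsFst_eq_zero hxX
  have hx2 : form52 x (gsSnd X Y) = 0 := form52_gsFst_eq_zero (by
    rw [gsRest, form52_sub_right, form52_smul_right, hx1, hxY]; ring)
  have hw := form52_timelikeRest_neg hx hX hY
  have hxw : form52 x (timelikePerp x) = 0 := by
    simp [form52, timelikePerp]; ring
  have hx0 : form52 x (timelikeUnit x X Y) = 0 := by
    simp [timelikeUnit, timelikeRest, form52_smul_right, form52_sub_right, hx1, hx2, hxw]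
  have h01 : form52 (timelikeUnit x X Y) (gsFst X) = 0 := by
    simp [timelikeUnit, timelikeRest, form52_smul_left, form52_sub_left, h1, h21]
  have h02 : form52 (timelikeUnit x X Y) (gsSnd X Y) = 0 := by
    simp [timelikeUnit, timelikeRest, form52_smul_left, form52_sub_left, h2, h12]
  have h00 : form52 (timelikeUnit x X Y) (timelikeUnit x X Y) = -1 := by
    rw [timelikeUnit, form52_smul_left, form52_smul_right, ← mul_assoc, ← mul_inv,
      Real.mul_self_sqrt (by linarith)]
    rw [inv_neg, neg_mul, inv_mul_cancel₀ hw.ne]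
  have hc := form52_cross_self hx h00 h1 h2 hx0 hx1 hx2 h01 h02 h12
  have z : ∀ (v : Fin 5 → R5) (i j : Fin 5), v i = v j → i ≠ j →
    det5 (v 0) (v 1) (v 2) (v 3) (v 4) = 0 := fun v i j a b => det5_eq_zero v a b
  set n := timelikeUnit x X Y
  set c := gsFst X
  set d := gsSnd X Y
  have cx : form52 (cross x n c d) x = 0 := by
    rw [form52_cross]; exact z ![x, n, x, c, d] 0 2 rfl (by decide)
  have cn : form52 (cross x n c d) n = 0 := by
    rw [form52_cross]; exact z ![x, n, n, c, d] 1 2 rfl (by decide)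
  have cc : form52 (cross x n c d) c = 0 := by
    rw [form52_cross]; exact z ![x, n, c, c, d] 2 3 rfl (by decide)
  have cd : form52 (cross x n c d) d = 0 := by
    rw [form52_cross]; exact z ![x, n, d, c, d] 2 4 rfl (by decide)
  refine ⟨⟨hx, fun i => ?_, fun i j => ?_⟩, ?_⟩
  · fin_cases i
    · exact hx0
    · exact (form52_comm _ _).trans cx
    · exact hx1
    · exact hx2
  · have e : gsFrame x X Y = ![n, cross x n c d, c, d] := rfl
    rw [e]
    fin_cases i <;> fin_cases j <;>
      simp [h00, hc, h1, h2, h12, h21, h01, h02, cn, cc, cd, form52_comm n (cross x n c d),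
        form52_comm c (cross x n c d), form52_comm d (cross x n c d), form52_comm c n,
        form52_comm d n]
  · change 0 < det5 x n (cross x n c d) c d
    rw [← form52_cross, hc]
    exact one_pos

/-! ### Smoothness of the frames -/

section Smooth

variable {N : Type*} [TopologicalSpace N] [ChartedSpace (EuclideanSpace ℝ (Fin 2)) N]
  {a b c d : N → R5} {p : N}

theorem contDiff_form52 : ContDiff ℝ ∞ fun z : R5 × R5 => form52 z.1 z.2 := by
  unfold form52
  fun_prop

theorem contDiff_cross :
    ContDiff ℝ ∞ fun z : (R5 × R5) × (R5 × R5) => cross z.1.1 z.1.2 z.2.1 z.2.2 := by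
  rw [contDiff_pi]
  intro i
  refine contDiff_const.mul ?_
  simp only [det5, Matrix.det_apply]
  refine ContDiff.sum fun σ _ => ContDiff.const_smul _ (contDiff_prod fun j _ => ?_)
  generalize σ j = k
  fin_cases k <;> simp <;> fun_prop

theorem contMDiffAt_form52 (ha : ContMDiffAt (𝓡 2) 𝓘(ℝ, R5) ∞ a p)
    (hb : ContMDiffAt (𝓡 2) 𝓘(ℝ, R5) ∞ b p) :
    ContMDiffAt (𝓡 2) 𝓘(ℝ, ℝ) ∞ (fun q => form52 (a q) (b q)) p :=
  contDiff_form52.contDiffAt.contMDiffAt.comp p (ha.prodMk_space hb)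

theorem contMDiffAt_cross (ha : ContMDiffAt (𝓡 2) 𝓘(ℝ, R5) ∞ a p)
    (hb : ContMDiffAt (𝓡 2) 𝓘(ℝ, R5) ∞ b p) (hc : ContMDiffAt (𝓡 2) 𝓘(ℝ, R5) ∞ c p)
    (hd : ContMDiffAt (𝓡 2) 𝓘(ℝ, R5) ∞ d p) :
    ContMDiffAt (𝓡 2) 𝓘(ℝ, R5) ∞ (fun q => cross (a q) (b q) (c q) (d q)) p := by
  have hz : ContMDiffAt (𝓡 2) 𝓘(ℝ, (R5 × R5) × (R5 × R5)) ∞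
      (fun q => ((a q, b q), (c q, d q))) p :=
    (ha.prodMk_space hb).prodMk_space (hc.prodMk_space hd)
  have h := contDiff_cross.contMDiff.contMDiffAt (x := ((a p, b p), (c p, d p)))
  exact h.comp p hz

theorem contMDiffAt_sqrt_inv_smul {s : N → ℝ} (hs : ContMDiffAt (𝓡 2) 𝓘(ℝ, ℝ) ∞ s p)
    (hp : 0 < s p) (ha : ContMDiffAt (𝓡 2) 𝓘(ℝ, R5) ∞ a p) :
    ContMDiffAt (𝓡 2) 𝓘(ℝ, R5) ∞ (fun q => (√(s q))⁻¹ • a q) p := by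
  have h : ContDiffAt ℝ ∞ (fun t : ℝ => (√t)⁻¹) (s p) :=
    (Real.contDiffAt_sqrt hp.ne').inv (Real.sqrt_pos.2 hp).ne'
  exact (h.contMDiffAt.comp p hs).smul ha

theorem contMDiffAt_gsFst (ha : ContMDiffAt (𝓡 2) 𝓘(ℝ, R5) ∞ a p)
    (hp : 0 < form52 (a p) (a p)) : ContMDiffAt (𝓡 2) 𝓘(ℝ, R5) ∞ (fun q => gsFst (a q)) p :=
  contMDiffAt_sqrt_inv_smul (contMDiffAt_form52 ha ha) hp ha

theorem contMDiffAt_gsRest (ha : ContMDiffAt (𝓡 2) 𝓘(ℝ, R5) ∞ a p)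
    (hb : ContMDiffAt (𝓡 2) 𝓘(ℝ, R5) ∞ b p) (hp : 0 < form52 (a p) (a p)) :
    ContMDiffAt (𝓡 2) 𝓘(ℝ, R5) ∞ (fun q => gsRest (a q) (b q)) p :=
  hb.sub ((contMDiffAt_form52 hb (contMDiffAt_gsFst ha hp)).smul (contMDiffAt_gsFst ha hp))

/-- Explicit Gram–Schmidt formulas make smoothness visible: every square root is taken of a function
that is positive at the point. -/
theorem contMDiffAt_gsFrame {x X Y : N → R5} (hx : ContMDiffAt (𝓡 2) 𝓘(ℝ, R5) ∞ x p)
    (hX : ContMDiffAt (𝓡 2) 𝓘(ℝ, R5) ∞ X p) (hY : ContMDiffAt (𝓡 2) 𝓘(ℝ, R5) ∞ Y p)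
    (hxp : form52 (x p) (x p) = -1) (hXp : 0 < form52 (X p) (X p))
    (hYp : 0 < form52 (gsRest (X p) (Y p)) (gsRest (X p) (Y p))) (i : Fin 4) :
    ContMDiffAt (𝓡 2) 𝓘(ℝ, R5) ∞ (fun q => gsFrame (x q) (X q) (Y q) i) p := by
  have h1 := contMDiffAt_gsFst hX hXp
  have h2 : ContMDiffAt (𝓡 2) 𝓘(ℝ, R5) ∞ (fun q => gsSnd (X q) (Y q)) p :=
    contMDiffAt_gsFst (contMDiffAt_gsRest hX hY hXp) hYp
  have hw : ContMDiffAt (𝓡 2) 𝓘(ℝ, R5) ∞ (fun q => timelikePerp (x q)) p := by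
    have : ContDiff ℝ ∞ timelikePerp := by
      rw [contDiff_pi]
      intro i
      fin_cases i <;> simp [timelikePerp] <;> fun_prop
    exact this.contDiffAt.contMDiffAt.comp p hx
  have hr : ContMDiffAt (𝓡 2) 𝓘(ℝ, R5) ∞ (fun q => timelikeRest (x q) (X q) (Y q)) p :=
    (hw.sub ((contMDiffAt_form52 hw h1).smul h1)).sub ((contMDiffAt_form52 hw h2).smul h2)
  have h0 : ContMDiffAt (𝓡 2) 𝓘(ℝ, R5) ∞ (fun q => timelikeUnit (x q) (X q) (Y q)) p :=
    contMDiffAt_sqrt_inv_smul (contMDiffAt_form52 hr hr).neg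
      (neg_pos.2 (form52_timelikeRest_neg hxp hXp hYp)) hr
  fin_cases i
  · exact h0
  · exact contMDiffAt_cross hx h0 h1 h2
  · exact h1
  · exact h2

end Smooth

/-! ### Darboux frames along an immersion -/

section Orientation

variable {V : Type*} [AddCommGroup V] [Module ℝ V]

theorem exists_basis_orientation_eq (b : Module.Basis (Fin 2) ℝ V) {r s t : ℝ} (hr : 0 < r)
    (ht : 0 < t) : ∃ b' : Module.Basis (Fin 2) ℝ V, b' 0 = r • b 0 ∧
      b' 1 = s • b 0 + t • b 1 ∧ b'.orientation = b.orientation := by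
  have hdet : b.det ![r • b 0, s • b 0 + t • b 1] = r * t := by
    simp [Module.Basis.det_apply, Matrix.det_fin_two, Module.Basis.toMatrix_apply]
  obtain ⟨h1, h2⟩ := (Module.Basis.is_basis_iff_det b
    (v := ![r • b 0, s • b 0 + t • b 1])).2 (by rw [hdet]; exact (mul_pos hr ht).ne'.isUnit)
  refine ⟨Module.Basis.mk h1 h2.ge, by simp, by simp, ?_⟩
  rw [eq_comm, Module.Basis.orientation_eq_iff_det_pos, Module.Basis.coe_mk, hdet]
  exact mul_pos hr ht

theorem exists_coeff_of_orientation_eq {b b' : Module.Basis (Fin 2) ℝ V}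
    (h : b'.orientation = b.orientation) : ∃ α β γ δ : ℝ, b' 0 = α • b 0 + β • b 1 ∧
      b' 1 = γ • b 0 + δ • b 1 ∧ 0 < α * δ - β * γ := by
  refine ⟨b.repr (b' 0) 0, b.repr (b' 0) 1, b.repr (b' 1) 0, b.repr (b' 1) 1, ?_, ?_, ?_⟩
  · rw [← Fin.sum_univ_two (fun i => b.repr (b' 0) i • b i), b.sum_repr]
  · rw [← Fin.sum_univ_two (fun i => b.repr (b' 1) i • b i), b.sum_repr]
  · rw [eq_comm, Module.Basis.orientation_eq_iff_det_pos] at h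
    simp only [Module.Basis.det_apply, Matrix.det_fin_two, Module.Basis.toMatrix_apply] at h
    linarith

end Orientation

section Surface

variable {N : Type*} [TopologicalSpace N] [ChartedSpace (EuclideanSpace ℝ (Fin 2)) N]
  {f : N → R5} {o : ∀ p : N, Orientation ℝ (TangentSpace (𝓡 2) p) (Fin 2)} {p : N}
  {e e' : Fin 4 → R5}

/-- The field is the fibre component of the tangent map composed with the section `Y`. -/
theorem contMDiffAt_dmap [IsManifold (𝓡 2) ∞ N] (hf : ContMDiff (𝓡 2) 𝓘(ℝ, R5) ∞ f)
    {Y : ∀ q : N, TangentSpace (𝓡 2) q} (hY : SmoothFieldAt Y p) :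
    ContMDiffAt (𝓡 2) 𝓘(ℝ, R5) ∞ (fun q => dmap f q (Y q)) p := by
  have h1 : ContMDiff (𝓡 2).tangent 𝓘(ℝ, R5).tangent ∞ (tangentMap (𝓡 2) 𝓘(ℝ, R5) f) :=
    hf.contMDiff_tangentMap le_rfl
  have h2 := contMDiff_snd_tangentBundle_modelSpace (n := ∞) R5 𝓘(ℝ, R5)
  exact (h2.comp h1).contMDiffAt.comp p hY

/-- The scalar product of `ℝ⁵₂` as a continuous bilinear map. -/
noncomputable def form52B : R5 →L[ℝ] R5 →L[ℝ] ℝ :=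
  LinearMap.toContinuousLinearMap
    { toFun := form52L
      map_add' := fun x y => ContinuousLinearMap.ext fun z => form52_add_left x y z
      map_smul' := fun c x => ContinuousLinearMap.ext fun z => form52_smul_left c x z }

/-- Leibniz rule for a constant scalar product; it yields all the orthogonality relations for the
differential of the null field. -/
theorem form52_dmap_add_eq_zero {a b : N → R5} {c : ℝ}
    (ha : MDifferentiableAt (𝓡 2) 𝓘(ℝ, R5) a p) (hb : MDifferentiableAt (𝓡 2) 𝓘(ℝ, R5) b p)
    (h : ∀ᶠ q in 𝓝 p, form52 (a q) (b q) = c) (v : TangentSpace (𝓡 2) p) :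
    form52 (dmap a p v) (b p) + form52 (a p) (dmap b p v) = 0 := by
  have h1 : HasFDerivAt (fun z : R5 × R5 => form52 z.1 z.2) _ (a p, b p) :=
    form52B.hasFDerivAt_of_bilinear hasFDerivAt_fst hasFDerivAt_snd
  have hab : HasMFDerivAt (𝓡 2) 𝓘(ℝ, R5 × R5) (fun q => (a q, b q)) p
      ((dmap a p).prod (dmap b p)) :=
    ⟨ha.hasMFDerivAt.1.prodMk hb.hasMFDerivAt.1, ha.hasMFDerivAt.2.prodMk hb.hasMFDerivAt.2⟩
  have h2 := HasMFDerivAt.comp (f := fun q => (a q, b q)) p h1.hasMFDerivAt hab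
  have h3 : HasMFDerivAt (𝓡 2) 𝓘(ℝ, ℝ) (fun q => form52 (a q) (b q)) p 0 :=
    (hasMFDerivAt_const (I := 𝓡 2) (I' := 𝓘(ℝ, ℝ)) c p).congr_of_eventuallyEq h
  have h4 := DFunLike.congr_fun (hasMFDerivAt_unique h2 h3) v
  change form52 (a p) (dmap b p v) + form52 (dmap a p v) (b p) = 0 at h4
  linarith

theorem IsDarbouxFrame.pseudoOrthonormal (h : IsDarbouxFrame f o p e) (hp : f p ∈ H41) :
    PseudoOrthonormal (f p) e :=
  ⟨hp, h.tangent, h.orthonormal⟩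

theorem IsDarbouxFrame.cross_null (h : IsDarbouxFrame f o p e) (hp : f p ∈ H41) :
    cross (f p) (e 0 + e 1) (e 2) (e 3) = e 0 + e 1 :=
  (h.pseudoOrthonormal hp).cross_null h.positive

theorem IsDarbouxFrame.cross_eq (h : IsDarbouxFrame f o p e) (h' : IsDarbouxFrame f o p e')
    (u : R5) : cross (f p) u (e' 2) (e' 3) = cross (f p) u (e 2) (e 3) := by
  obtain ⟨b, hb, h0, h1⟩ := h.adapted
  obtain ⟨b', hb', h0', h1'⟩ := h'.adapted
  obtain ⟨α, β, γ, δ, e0, e1, hpos⟩ := exists_coeff_of_orientation_eq (hb'.trans hb.symm)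
  rw [e0, map_add, map_smul, map_smul, h0, h1] at h0'
  rw [e1, map_add, map_smul, map_smul, h0, h1] at h1'
  have o22 := h'.orthonormal 2 2
  have o23 := h'.orthonormal 2 3
  have o33 := h'.orthonormal 3 3
  simp [← h0', ← h1', form52_add_left, form52_add_right, form52_smul_left, form52_smul_right,
    h.orthonormal] at o22 o23 o33
  -- Lagrange's identity: the transition matrix between two orthonormal bases has determinant `±1`,
  -- and the orientation selects `1`.
  have hsq : (α * δ - β * γ) ^ 2 = 1 := by
    have : (α * δ - β * γ) ^ 2 = (α * α + β * β) * (γ * γ + δ * δ) - (α * γ + β * δ) ^ 2 := by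
      ring
    rw [this, o22, o33, mul_comm α, mul_comm β, o23]; norm_num
  have h1 : α * δ - β * γ = 1 := by nlinarith
  rw [← h0', ← h1', cross_rotate, h1, one_smul]

/-- The null vectors of two frames are fixed by the same operator `cross (f p) · (e 2) (e 3)`, whose
form is skew; so they are orthogonal to each other, and in the Lorentzian normal plane a vector
orthogonal to a null vector is a multiple of it. -/
theorem plusNullLine_eq (h : IsDarbouxFrame f o p e) (hp : f p ∈ H41) :
    plusNullLine f o p = Submodule.span ℝ {e 0 + e 1} := by
  apply le_antisymm
  · refine Submodule.span_le.2 ?_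
    rintro _ ⟨e', h', rfl⟩
    have P := h.pseudoOrthonormal hp
    have hc := h'.cross_null hp
    rw [h.cross_eq h'] at hc
    have hz : ∀ w, w = f p ∨ w = e 2 ∨ w = e 3 → form52 (e' 0 + e' 1) w = 0 := by
      intro w hw
      rw [← hc, form52_cross]
      rcases hw with rfl | rfl | rfl
      · exact det5_eq_zero ![f p, _, f p, e 2, e 3] (i := 0) (j := 2) rfl (by decide)
      · exact det5_eq_zero ![f p, _, e 2, e 2, e 3] (i := 2) (j := 3) rfl (by decide)
      · exact det5_eq_zero ![f p, _, e 3, e 2, e 3] (i := 2) (j := 4) rfl (by decide)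
    have := P.mem_span_null (hz _ (by simp)) (hz _ (by simp)) (hz _ (by simp))
      (form52_eq_zero_of_cross_eq hc (h.cross_null hp))
    exact Submodule.mem_span_singleton.2 ⟨_, this.symm⟩
  · exact Submodule.span_mono (by rintro _ rfl; exact ⟨e, h, rfl⟩)

theorem covDeriv_eq (f : N → R5) (p : N) (v : TangentSpace (𝓡 2) p)
    (Y : ∀ q : N, TangentSpace (𝓡 2) q) :
    covDeriv f p v Y = dmap (fun q => dmap f q (Y q)) p v
      + form52 (dmap (fun q => dmap f q (Y q)) p v) (f p) • f p := rfl

variable [RiemannianBundle (fun p : N => TangentSpace (𝓡 2) p)]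

theorem IsIsometricImmersion.form52_dmap (hf : IsIsometricImmersion f) (p : N)
    (v : TangentSpace (𝓡 2) p) : form52 (f p) (dmap f p v) = 0 := by
  have h : MDifferentiableAt (𝓡 2) 𝓘(ℝ, R5) f p := (hf.smooth p).mdifferentiableAt (by simp)
  have := form52_dmap_add_eq_zero h h (c := -1) (Filter.Eventually.of_forall hf.mem) v
  rw [form52_comm] at this
  linarith

/-- Pairing with the null normal discards the corrections along `f` and along the surface, so the
flat derivative pairs as the second fundamental form does; that is a multiple of the null normal
itself. -/
theorem form52_secondFundamentalForm [IsManifold (𝓡 2) ∞ N] (hf : IsIsometricImmersion f)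
    (h : IsDarbouxFrame f o p e) (hiso : IsPlusIsotropic f o)
    (v : TangentSpace (𝓡 2) p) {Y : ∀ q : N, TangentSpace (𝓡 2) q} (hY : SmoothFieldAt Y p) :
    form52 (e 0 + e 1) (dmap (fun q => dmap f q (Y q)) p v) = 0 := by
  have hII := hiso p v Y hY
  rw [plusNullLine_eq h (hf.mem p)] at hII
  obtain ⟨c, hc⟩ := Submodule.mem_span_singleton.1 hII
  have P := h.pseudoOrthonormal (hf.mem p)
  have hnull : form52 (e 0 + e 1) (e 0 + e 1) = 0 := by
    simp [form52_add_left, form52_add_right, P.orthonormal]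
  obtain ⟨b, -, h0, h1⟩ := h.adapted
  have htan : ∀ w, form52 (e 0 + e 1) (dmap f p w) = 0 := fun w => by
    rw [← b.sum_repr w, Fin.sum_univ_two, map_add, map_smul, map_smul, h0, h1]
    simp [form52_add_left, form52_add_right, form52_smul_right, P.orthonormal]
  have hx : form52 (e 0 + e 1) (f p) = 0 := by
    simp [form52_add_left, P.tangent']
  have := congrArg (form52 (e 0 + e 1)) hc
  rw [secondFundamentalForm, covDeriv_eq, form52_smul_right, hnull, form52_sub_right, htan] at this
  rw [form52_add_right, form52_smul_right, hx] at this
  simpa using this.symm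

/-- The fields `X` and `Y` are kept alongside the frame because isotropy is tested on smooth tangent
fields; `e 2` and `e 3` are recovered as their combinations. -/
theorem exists_darbouxFrame [IsManifold (𝓡 2) ∞ N] (ho : IsSurfaceOrientation o)
    (hf : IsIsometricImmersion f) (p : N) :
    ∃ U : Set N, IsOpen U ∧ p ∈ U ∧ ∃ (e : N → Fin 4 → R5)
      (X Y : ∀ q : N, TangentSpace (𝓡 2) q), ∀ q ∈ U, IsDarbouxFrame f o q (e q) ∧
        (∀ i, ContMDiffAt (𝓡 2) 𝓘(ℝ, R5) ∞ (fun q => e q i) q) ∧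
        SmoothFieldAt X q ∧ SmoothFieldAt Y q ∧
        ∃ r s t : ℝ, e q 2 = r • dmap f q (X q) ∧
          e q 3 = s • dmap f q (X q) + t • dmap f q (Y q) := by
  obtain ⟨U, hU, hp, X, Y, h⟩ := ho p
  refine ⟨U, hU, hp, fun q => gsFrame (f q) (dmap f q (X q)) (dmap f q (Y q)), X, Y,
    fun q hq => ?_⟩
  obtain ⟨hX, hY, b, hb0, hb1, hb⟩ := h q hq
  have hpos : ∀ v : TangentSpace (𝓡 2) q, v ≠ 0 → 0 < form52 (dmap f q v) (dmap f q v) :=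
    fun v hv => by rw [hf.isometric]; exact real_inner_self_pos.2 hv
  have hXq : 0 < form52 (dmap f q (X q)) (dmap f q (X q)) := hpos _ (hb0 ▸ b.ne_zero 0)
  set x := dmap f q (X q) with hx
  set y := dmap f q (Y q) with hy
  set r := (√(form52 x x))⁻¹ with hr
  have hr0 : 0 < r := inv_pos.2 (Real.sqrt_pos.2 hXq)
  set s := form52 y (gsFst x) * r with hs
  have hrest : gsRest x y = dmap f q (Y q - s • X q) := by
    rw [map_sub, map_smul, ← hx, ← hy, hs, gsRest, mul_smul]; rfl
  have hYq : 0 < form52 (gsRest x y) (gsRest x y) := by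
    rw [hrest]
    refine hpos _ fun h0 => ?_
    have h2 := congrArg (fun v => b.repr v 1) h0
    rw [← hb0, ← hb1] at h2
    simp at h2
  set t := (√(form52 (gsRest x y) (gsRest x y)))⁻¹ with ht
  have ht0 : 0 < t := inv_pos.2 (Real.sqrt_pos.2 hYq)
  obtain ⟨P, hdet⟩ := gsFrame_spec (hf.mem q) (hf.form52_dmap q (X q)) (hf.form52_dmap q (Y q))
    hXq hYq
  obtain ⟨b', h0, h1, hb'⟩ := exists_basis_orientation_eq b (s := -(t * s)) hr0 ht0
  have e2 : gsFrame (f q) x y 2 = r • x := rfl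
  have e3 : gsFrame (f q) x y 3 = (-(t * s)) • x + t • y := by
    change t • gsRest x y = _
    rw [hrest, map_sub, map_smul, ← hx, ← hy]
    module
  refine ⟨⟨P.tangent, P.orthonormal, hdet, b', hb'.trans hb, ?_, ?_⟩, fun i => ?_, hX, hY,
    r, -(t * s), t, e2, e3⟩
  · rw [h0, hb0, map_smul]; exact e2.symm
  · rw [h1, hb0, hb1, map_add, map_smul, map_smul]; exact e3.symm
  · exact contMDiffAt_gsFrame (hf.smooth q) (contMDiffAt_dmap hf.smooth hX)
      (contMDiffAt_dmap hf.smooth hY) (hf.mem q) hXq hYq i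

end Surface

/-! ### The null direction is constant -/

/-- A map whose derivative is everywhere proportional to the map spans a constant line. -/
theorem span_eq_of_fderiv_proportional {E : Type*} [NormedAddCommGroup E] [NormedSpace ℝ E]
    {F : E → R5} {B : Set E} (hB : IsOpen B) (hB' : IsPreconnected B)
    (hF : ∀ x ∈ B, DifferentiableAt ℝ F x) {i : Fin 5} (hi : ∀ x ∈ B, F x i ≠ 0)
    (h : ∀ x ∈ B, ∀ w, ∃ c : ℝ, fderiv ℝ F x w = c • F x) {x y : E} (hx : x ∈ B) (hy : y ∈ B) :
    Submodule.span ℝ {F x} = Submodule.span ℝ {F y} := by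
  have hc : ∀ x ∈ B, ∀ j, HasFDerivAt (fun x => F x j)
      ((ContinuousLinearMap.proj j).comp (fderiv ℝ F x)) x := fun x hx j =>
    (ContinuousLinearMap.proj (R := ℝ) (φ := fun _ : Fin 5 => ℝ) j).hasFDerivAt.comp x
      (hF x hx).hasFDerivAt
  -- If `dF = cF`, the quotient rule makes every ratio of coordinates have zero derivative.
  have key : ∀ j, F x j / F x i = F y j / F y i := fun j => by
    have hd : ∀ x ∈ B, HasFDerivAt (fun x => F x j / F x i) (F x j • -(F x i ^ 2)⁻¹ •
        (ContinuousLinearMap.proj i).comp (fderiv ℝ F x) +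
        (F x i)⁻¹ • (ContinuousLinearMap.proj j).comp (fderiv ℝ F x)) x := fun x hx => by
      simp only [div_eq_mul_inv]
      exact (hc x hx j).mul ((hasDerivAt_inv (hi x hx)).comp_hasFDerivAt x (hc x hx i))
    refine hB.is_const_of_fderiv_eq_zero (𝕜 := ℝ) (f := fun x => F x j / F x i) hB' ?_ ?_ hx hy
    · exact fun x hx => (hd x hx).differentiableAt.differentiableWithinAt
    · intro x hx
      rw [(hd x hx).fderiv]
      ext w
      obtain ⟨c, hcw⟩ := h x hx w
      have := hi x hx
      simp [hcw]
      field_simp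
      ring
  have hs : F x = (F x i / F y i) • F y := by
    funext j
    have := key j
    have h1 := hi x hx
    have h2 := hi y hy
    field_simp at this
    simp only [Pi.smul_apply, smul_eq_mul]
    field_simp
    linarith
  rw [hs]
  exact Submodule.span_singleton_smul_eq (div_ne_zero (hi x hx) (hi y hy)).isUnit _

section Surface

variable {N : Type*} [TopologicalSpace N] [ChartedSpace (EuclideanSpace ℝ (Fin 2)) N]
  [IsManifold (𝓡 2) ∞ N]
  {f : N → R5} {o : ∀ p : N, Orientation ℝ (TangentSpace (𝓡 2) p) (Fin 2)}

/-- A vector field along the surface whose differential is everywhere proportional to it spans a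
locally constant line. -/
theorem eventually_span_eq {ν : N → R5} {p : N}
    (hν : ∀ᶠ q in 𝓝 p, ContMDiffAt (𝓡 2) 𝓘(ℝ, R5) ∞ ν q) (h0 : ν p ≠ 0)
    (h : ∀ᶠ q in 𝓝 p, ∀ v, ∃ c : ℝ, dmap ν q v = c • ν q) :
    ∀ᶠ q in 𝓝 p, Submodule.span ℝ {ν q} = Submodule.span ℝ {ν p} := by
  obtain ⟨i, hi⟩ := Function.ne_iff.1 h0
  have hi' : ∀ᶠ q in 𝓝 p, ν q i ≠ 0 :=
    ((continuous_apply i).continuousAt.comp hν.self_of_nhds.continuousAt).eventually_ne hi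
  set φ := extChartAt (𝓡 2) p
  have hmem : φ p ∈ φ.target := mem_extChartAt_target p
  have hpre : ∀ᶠ x in 𝓝 (φ p), x ∈ φ.target ∧ ContMDiffAt (𝓡 2) 𝓘(ℝ, R5) ∞ ν (φ.symm x) ∧
      (∀ v, ∃ c : ℝ, dmap ν (φ.symm x) v = c • ν (φ.symm x)) ∧ ν (φ.symm x) i ≠ 0 := by
    have ht : ∀ᶠ x in 𝓝 (φ p), x ∈ φ.target := (isOpen_extChartAt_target p).mem_nhds hmem
    refine ht.and ?_
    have := (continuousAt_extChartAt_symm (I := 𝓡 2) p)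
    rw [ContinuousAt, extChartAt_to_inv] at this
    exact this.eventually (hν.and (h.and hi'))
  obtain ⟨r, hr, hball⟩ := Metric.eventually_nhds_iff_ball.1 hpre
  have hd : ∀ x ∈ Metric.ball (φ p) r, ∃ D : EuclideanSpace ℝ (Fin 2) →L[ℝ] R5,
      HasFDerivAt (fun x => ν (φ.symm x)) D x ∧ ∀ w, ∃ c : ℝ, D w = c • ν (φ.symm x) := by
    intro x hx
    obtain ⟨hxt, hxs, hxd, -⟩ := hball x hx
    have h1 : MDifferentiableAt 𝓘(ℝ, EuclideanSpace ℝ (Fin 2)) (𝓡 2) φ.symm x :=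
      ((contMDiffOn_extChartAt_symm (I := 𝓡 2) (n := ∞) p).contMDiffAt
        ((isOpen_extChartAt_target p).mem_nhds hxt)).mdifferentiableAt (by simp)
    have h2 := (hxs.mdifferentiableAt (by simp)).hasMFDerivAt.comp x h1.hasMFDerivAt
    exact ⟨_, h2.hasFDerivAt, fun w => hxd _⟩
  have hsrc : ∀ᶠ q in 𝓝 p, q ∈ φ.source := extChartAt_source_mem_nhds p
  have hq : ∀ᶠ q in 𝓝 p, q ∈ φ.source ∧ φ q ∈ Metric.ball (φ p) r :=
    hsrc.and ((continuousAt_extChartAt p).eventually_mem (Metric.ball_mem_nhds _ hr))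
  filter_upwards [hq] with q ⟨hqs, hqb⟩
  have := span_eq_of_fderiv_proportional (F := fun x => ν (φ.symm x)) Metric.isOpen_ball
    (convex_ball (φ p) r).isPreconnected (fun x hx => (hd x hx).choose_spec.1.differentiableAt)
    (i := i) (fun x hx => (hball x hx).2.2.2) (fun x hx w => ?_) hqb (Metric.mem_ball_self hr)
  · simpa only [φ.left_inv hqs, φ.left_inv (mem_extChartAt_source p)] using this
  · obtain ⟨D, hD, hDw⟩ := hd x hx
    rw [hD.fderiv]
    exact hDw w

variable [RiemannianBundle (fun p : N => TangentSpace (𝓡 2) p)]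

/-- The differential of the null field is shown to be orthogonal to the field, to `f` and to the
surface, hence proportional to the field. -/
theorem isLocallyConstant_plusNullLine (ho : IsSurfaceOrientation o)
    (hf : IsIsometricImmersion f) (hiso : IsPlusIsotropic f o) :
    IsLocallyConstant (plusNullLine f o) := by
  refine (IsLocallyConstant.iff_eventually_eq _).2 fun p => ?_
  obtain ⟨U, hU, hp, e, X, Y, h⟩ := exists_darbouxFrame ho hf p
  have hUp : ∀ᶠ q in 𝓝 p, q ∈ U := hU.mem_nhds hp
  have hP : ∀ q ∈ U, PseudoOrthonormal (f q) (e q) := fun q hq =>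
    (h q hq).1.pseudoOrthonormal (hf.mem q)
  have hsm : ∀ q ∈ U, ContMDiffAt (𝓡 2) 𝓘(ℝ, R5) ∞ (fun q => e q 0 + e q 1) q := fun q hq =>
    ((h q hq).2.1 0).add ((h q hq).2.1 1)
  have hnull : ∀ q ∈ U, form52 (e q 0 + e q 1) (e q 0 + e q 1) = 0 := fun q hq => by
    simp [form52_add_left, form52_add_right, (hP q hq).orthonormal]
  have hx : ∀ q ∈ U, form52 (e q 0 + e q 1) (f q) = 0 := fun q hq => by
    simp [form52_add_left, (hP q hq).tangent']
  have htan : ∀ q ∈ U, ∀ w, form52 (e q 0 + e q 1) (dmap f q w) = 0 := fun q hq w => by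
    obtain ⟨b, -, h0, h1⟩ := (h q hq).1.adapted
    rw [← b.sum_repr w, Fin.sum_univ_two, map_add, map_smul, map_smul, h0, h1]
    simp [form52_add_left, form52_add_right, form52_smul_right, (hP q hq).orthonormal]
  have key := eventually_span_eq (ν := fun q => e q 0 + e q 1) (p := p) (hUp.mono hsm) ?_
    (hUp.mono fun q hq v => ?_)
  · filter_upwards [key, hUp] with q hq hqU
    rw [plusNullLine_eq (h q hqU).1 (hf.mem q), plusNullLine_eq (h p hp).1 (hf.mem p), hq]
  · intro h0
    have := congrArg (form52 (e p 1)) h0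
    simp [form52_add_right, (hP p hp).orthonormal, form52_zero_right] at this
  · have hUq : ∀ᶠ q' in 𝓝 q, q' ∈ U := hU.mem_nhds hq
    have hmd := (hsm q hq).mdifferentiableAt (by simp)
    obtain ⟨hD, -, hX, hY, r, s, t, e2, e3⟩ := h q hq
    have d1 := form52_dmap_add_eq_zero hmd hmd (hUq.mono hnull) v
    have d2 := form52_dmap_add_eq_zero hmd ((hf.smooth q).mdifferentiableAt (by simp))
      (hUq.mono hx) v
    have d3 : ∀ Z : ∀ q : N, TangentSpace (𝓡 2) q, SmoothFieldAt Z q →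
        form52 (dmap (fun q => e q 0 + e q 1) q v) (dmap f q (Z q)) = 0 := fun Z hZ => by
      have := form52_dmap_add_eq_zero hmd
        ((contMDiffAt_dmap hf.smooth hZ).mdifferentiableAt (by simp))
        (hUq.mono fun q' hq' => htan q' hq' _) v
      rwa [form52_secondFundamentalForm hf hD hiso v hZ, add_zero] at this
    rw [htan q hq, add_zero] at d2
    rw [form52_comm (e q 0 + e q 1)] at d1
    refine ⟨_, (hP q hq).mem_span_null d2 ?_ ?_ (by linarith)⟩
    · rw [e2, form52_smul_right, d3 X hX, mul_zero]
    · rw [e3, form52_add_right, form52_smul_right, form52_smul_right, d3 X hX, d3 Y hY]; ring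

/-- The linear isometry taking the standard basis to a pseudo-orthonormal basis. -/
theorem PseudoOrthonormal.exists_isometry {x : R5} {e : Fin 4 → R5} (h : PseudoOrthonormal x e) :
    ∃ A : R5 ≃ₗ[ℝ] R5, IsLinearIsometry52 A ∧ A ![1, 0, 0, 0, 0] = x ∧
      A ![0, 1, 1, 0, 0] = e 0 + e 1 := by
  let L : R5 →ₗ[ℝ] R5 :=
    { toFun := fun z => z 0 • x + z 1 • e 0 + z 2 • e 1 + z 3 • e 2 + z 4 • e 3
      map_add' := fun y z => by simp only [Pi.add_apply]; module
      map_smul' := fun c z => by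
        simp only [Pi.smul_apply, smul_eq_mul, RingHom.id_apply]; module }
  have hL : ∀ y z, form52 (L y) (L z) = form52 y z := fun y z => by
    simp [L, form52_add_left, form52_add_right, form52_smul_left, form52_smul_right, h.self,
      h.tangent, h.tangent', h.orthonormal]
    simp only [form52]; ring
  have hinj : Function.Injective L := by
    refine (injective_iff_map_eq_zero L).2 fun z hz => form52_nondegenerate fun u => ?_
    rw [← hL, hz, form52_zero_left]
  refine ⟨LinearEquiv.ofInjectiveEndo L hinj, hL, ?_, ?_⟩
  · simp [L]
  · simp [L]

/-- After a linear isometry, each component of a +isotropic surface lies in the hyperplane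
`x₂ = x₃`. -/
theorem exists_isometry_component (ho : IsSurfaceOrientation o)
    (hf : IsIsometricImmersion f) (hiso : IsPlusIsotropic f o) (p₀ : N) :
    ∃ A : R5 ≃ₗ[ℝ] R5, IsLinearIsometry52 A ∧ A.symm (f p₀) 0 = 1 ∧
      ∀ q ∈ connectedComponent p₀, A.symm (f q) 1 = A.symm (f q) 2 ∧
        ∀ v, A.symm (dmap f q v) 1 = A.symm (dmap f q v) 2 := by
  obtain ⟨U, hU, hp, e, X, Y, h⟩ := exists_darbouxFrame ho hf p₀
  have hD := (h p₀ hp).1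
  obtain ⟨A, hA, hA0, hA1⟩ := (hD.pseudoOrthonormal (hf.mem p₀)).exists_isometry
  refine ⟨A, hA, by rw [← hA0]; simp, fun q hq => ?_⟩
  have hline := (isLocallyConstant_plusNullLine ho hf hiso).apply_eq_of_isPreconnected
    isPreconnected_connectedComponent hq mem_connectedComponent
  obtain ⟨U', hU', hq', e', X', Y', h'⟩ := exists_darbouxFrame ho hf q
  have hD' := (h' q hq').1
  rw [plusNullLine_eq hD (hf.mem p₀), plusNullLine_eq hD' (hf.mem q)] at hline
  have hP := hD'.pseudoOrthonormal (hf.mem q)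
  obtain ⟨c, hc⟩ := Submodule.mem_span_singleton.1
    (hline ▸ Submodule.mem_span_singleton_self (e p₀ 0 + e p₀ 1))
  have key : ∀ z, form52 z (e' q 0 + e' q 1) = 0 → A.symm z 1 = A.symm z 2 := fun z hz => by
    have h1 : form52 (A.symm z) ![0, 1, 1, 0, 0] = 0 := by
      rw [← hA, A.apply_symm_apply, hA1, ← hc, form52_smul_right, hz, mul_zero]
    simp [form52] at h1
    linarith
  refine ⟨key _ (by simp [form52_add_right, hP.tangent]), fun v => key _ ?_⟩
  obtain ⟨b, -, h0, h1⟩ := hD'.adapted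
  rw [← b.sum_repr v, Fin.sum_univ_two, map_add, map_smul, map_smul, h0, h1]
  simp [form52_add_left, form52_add_right, form52_smul_left, hP.orthonormal]

end Surface

/-! ### The inverse function theorem on a surface -/

section InverseFunction

variable {N : Type*} [TopologicalSpace N] [ChartedSpace (EuclideanSpace ℝ (Fin 2)) N]
  [IsManifold (𝓡 2) ∞ N]

/-- A smooth map into the plane with injective differential is a local diffeomorphism. -/
theorem exists_partialDiffeomorph {u : N → EuclideanSpace ℝ (Fin 2)} {W : Set N} (hW : IsOpen W)
    (hu : ContMDiff (𝓡 2) (𝓡 2) ∞ u)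
    (hinj : ∀ q ∈ W, Function.Injective (mfderiv (𝓡 2) (𝓡 2) u q)) {p : N} (hp : p ∈ W) :
    ∃ Φ : PartialDiffeomorph (𝓡 2) (𝓡 2) N (EuclideanSpace ℝ (Fin 2)) ∞,
      p ∈ Φ.source ∧ Φ.source ⊆ W ∧ ∀ q ∈ Φ.source, Φ q = u q := by
  set c := chartAt (EuclideanSpace ℝ (Fin 2)) p with hc
  set T := c.target ∩ c.symm ⁻¹' W with hT
  have hTo : IsOpen T := c.isOpen_inter_preimage_symm hW
  set F : EuclideanSpace ℝ (Fin 2) → EuclideanSpace ℝ (Fin 2) := fun x => u (c.symm x) with hF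
  have hcs : ∀ x ∈ T, ContMDiffAt (𝓡 2) (𝓡 2) ∞ c.symm x := fun x hx =>
    (contMDiffOn_chart_symm (I := 𝓡 2) (n := ∞) (x := p)).contMDiffAt
      (c.open_target.mem_nhds hx.1)
  have hFs : ∀ x ∈ T, ContDiffAt ℝ ∞ F x := fun x hx =>
    (hu.contMDiffAt.comp x (hcs x hx)).contDiffAt
  have hFd : ∀ x ∈ T, ∃ D : EuclideanSpace ℝ (Fin 2) ≃L[ℝ] EuclideanSpace ℝ (Fin 2),
      HasFDerivAt F (D : EuclideanSpace ℝ (Fin 2) →L[ℝ] EuclideanSpace ℝ (Fin 2)) x := by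
    intro x hx
    have h1 := (hu.contMDiffAt.mdifferentiableAt (by simp)).hasMFDerivAt.comp x
      ((hcs x hx).mdifferentiableAt (by simp)).hasMFDerivAt
    have h2 : Function.Injective (mfderiv (𝓡 2) (𝓡 2) c.symm x) :=
      (mdifferentiable_chart (I := 𝓡 2) p).symm.mfderiv_injective hx.1
    obtain ⟨D, hD, hDi⟩ : ∃ D : EuclideanSpace ℝ (Fin 2) →L[ℝ] EuclideanSpace ℝ (Fin 2),
        HasFDerivAt F D x ∧ Function.Injective D :=
      ⟨_, h1.hasFDerivAt, (hinj _ hx.2).comp h2⟩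
    refine ⟨(LinearEquiv.ofInjectiveEndo D.toLinearMap hDi).toContinuousLinearEquiv, ?_⟩
    convert hD
    ext1 w
    rfl
  have hpT : c p ∈ T := ⟨mem_chart_target _ p, by
    simpa [hc, c.left_inv (mem_chart_source _ p)] using hp⟩
  obtain ⟨D, hD⟩ := hFd _ hpT
  -- Restricting to `T` keeps the differential of `F` invertible on the whole source, as smoothness
  -- of the inverse on the whole target requires.
  set e := ((hFs _ hpT).toOpenPartialHomeomorph F hD (by simp)).restrOpen T hTo with he
  have heF : ∀ x, e x = F x := fun x => rfl
  have hes : e.source ⊆ T := fun x hx => hx.2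
  set Ψ := c.trans e with hΨ
  have hsrc : ∀ q ∈ Ψ.source, q ∈ c.source ∧ c q ∈ e.source := fun q hq => by
    simpa [hΨ] using hq
  have hΨu : ∀ q ∈ Ψ.source, Ψ q = u q := fun q hq => by
    change F (c q) = u q
    simp only [hF]
    rw [c.left_inv (hsrc q hq).1]
  refine ⟨{ Ψ.toPartialEquiv with
    open_source := Ψ.open_source
    open_target := Ψ.open_target
    contMDiffOn_toFun := hu.contMDiffOn.congr hΨu
    contMDiffOn_invFun := ?_ }, ?_, ?_, hΨu⟩
  · intro y hy
    have hy' : y ∈ e.target := by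
      have : y ∈ Ψ.target := hy
      rw [hΨ, OpenPartialHomeomorph.trans_target] at this
      exact this.1
    have hT' : e.symm y ∈ T := hes (e.map_target hy')
    obtain ⟨D', hD'⟩ := hFd _ hT'
    have h1 : ContDiffAt ℝ ∞ e.symm y := e.contDiffAt_symm hy' hD' (hFs _ hT')
    exact ((hcs _ hT').comp y h1.contMDiffAt).contMDiffWithinAt
  · change p ∈ Ψ.source
    rw [hΨ, OpenPartialHomeomorph.trans_source]
    exact ⟨mem_chart_source _ p,
      (hFs _ hpT).mem_toOpenPartialHomeomorph_source hD (by simp), hpT⟩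
  · intro q hq
    have := (hes (hsrc q hq).2).2
    rwa [mem_preimage, c.left_inv (hsrc q hq).1] at this

end InverseFunction

/-! ### Expanding local diffeomorphisms from a complete surface -/

/-- The differential of a map from a surface to the plane. -/
noncomputable def planeDeriv {N : Type*} [TopologicalSpace N]
    [ChartedSpace (EuclideanSpace ℝ (Fin 2)) N] (u : N → EuclideanSpace ℝ (Fin 2)) (p : N) :
    TangentSpace (𝓡 2) p →L[ℝ] EuclideanSpace ℝ (Fin 2) :=
  mfderiv (𝓡 2) (𝓡 2) u p

section Expanding

open Filter
open scoped ENNReal NNReal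

variable {N : Type*} [EMetricSpace N] {u : N → EuclideanSpace ℝ (Fin 2)}

/-- `γ` lifts the line `t ↦ x + t w` over the set `s` of times. -/
def LiftsLine (u : N → EuclideanSpace ℝ (Fin 2)) (x w : EuclideanSpace ℝ (Fin 2)) (s : Set ℝ)
    (γ : ℝ → N) : Prop :=
  ContinuousOn γ s ∧ ∀ t ∈ s, u (γ t) = x + t • w

theorem LiftsLine.mono {x w : EuclideanSpace ℝ (Fin 2)} {s t : Set ℝ} {γ : ℝ → N}
    (h : LiftsLine u x w t γ) (hst : s ⊆ t) : LiftsLine u x w s γ :=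
  ⟨h.1.mono hst, fun r hr => h.2 r (hst hr)⟩

variable [ChartedSpace (EuclideanSpace ℝ (Fin 2)) N]

theorem LiftsLine.eqOn (hu : IsLocalDiffeomorph (𝓡 2) (𝓡 2) ∞ u)
    {x w : EuclideanSpace ℝ (Fin 2)} {s : Set ℝ} (hs : IsPreconnected s) {γ γ' : ℝ → N}
    (h : LiftsLine u x w s γ) (h' : LiftsLine u x w s γ') {a : ℝ} (ha : a ∈ s)
    (haa : γ a = γ' a) : EqOn γ γ' s :=
  (T2Space.isSeparatedMap u).eqOn_of_comp_eqOn hu.isLocalHomeomorph.isLocallyInjective hs h.1 h'.1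
    (fun t ht => (h.2 t ht).trans (h'.2 t ht).symm) ha haa

theorem LiftsLine.contMDiffOn (hu : IsLocalDiffeomorph (𝓡 2) (𝓡 2) ∞ u)
    {x w : EuclideanSpace ℝ (Fin 2)} {s : Set ℝ} {γ : ℝ → N} (h : LiftsLine u x w s γ) :
    ContMDiffOn 𝓘(ℝ, ℝ) (𝓡 2) 1 γ s := by
  intro t ht
  obtain ⟨Φ, hΦ, hΦu⟩ := hu (γ t)
  have hline : ContMDiff 𝓘(ℝ, ℝ) (𝓡 2) ∞ fun t : ℝ => x + t • w := by
    rw [contMDiff_iff_contDiff]; fun_prop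
  have hmem : x + t • w ∈ Φ.target := by
    rw [← h.2 t ht, hΦu hΦ]
    exact Φ.map_source hΦ
  have h1 : ContMDiffAt 𝓘(ℝ, ℝ) (𝓡 2) ∞ (fun t : ℝ => Φ.symm (x + t • w)) t :=
    (Φ.symm.contMDiffOn.contMDiffAt (Φ.open_target.mem_nhds hmem)).comp t hline.contMDiffAt
  have h2 : ∀ᶠ r in 𝓝[s] t, γ r ∈ Φ.source := (h.1 t ht).eventually_mem (Φ.open_source.mem_nhds hΦ)
  refine ((h1.of_le (by exact_mod_cast le_top)).contMDiffWithinAt).congr_of_eventuallyEq ?_ ?_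
  · filter_upwards [h2, self_mem_nhdsWithin] with r hr hrs
    rw [← h.2 r hrs, hΦu hr]
    exact (Φ.left_inv hr).symm
  · rw [← h.2 t ht, hΦu hΦ]
    exact (Φ.left_inv hΦ).symm

/-- The local inverse of `u` at the endpoint continues the lift. -/
theorem LiftsLine.eventually_exists (hu : IsLocalDiffeomorph (𝓡 2) (𝓡 2) ∞ u)
    {w : EuclideanSpace ℝ (Fin 2)} {q : N} {T : ℝ} (hT : 0 ≤ T) {γ : ℝ → N}
    (h : LiftsLine u (u q) w (Icc 0 T) γ) (h0 : γ 0 = q) :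
    ∀ᶠ T' in 𝓝[>] T, ∃ γ : ℝ → N, LiftsLine u (u q) w (Icc 0 T') γ ∧ γ 0 = q := by
  obtain ⟨Φ, hΦ, hΦu⟩ := hu (γ T)
  have hTm : T ∈ Icc 0 T := ⟨hT, le_rfl⟩
  have hline : Continuous fun t : ℝ => u q + t • w := by fun_prop
  have hmem : u q + T • w ∈ Φ.target := by
    rw [← h.2 T hTm, hΦu hΦ]
    exact Φ.map_source hΦ
  have hopen : IsOpen ((fun t : ℝ => u q + t • w) ⁻¹' Φ.target) := Φ.open_target.preimage hline
  obtain ⟨ε, hε, hball⟩ := Metric.isOpen_iff.1 hopen T hmem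
  filter_upwards [Ioo_mem_nhdsGT (lt_add_of_pos_right T hε)] with T' hT'
  have hsub : ∀ t ∈ Icc T T', u q + t • w ∈ Φ.target := fun t ht =>
    hball (by rw [Metric.mem_ball, Real.dist_eq, abs_of_nonneg (by linarith [ht.1])]
              linarith [ht.2, hT'.2])
  set g : ℝ → N := fun t => if t ≤ T then γ t else Φ.symm (u q + t • w) with hg
  have hg1 : EqOn g γ (Icc 0 T) := fun t ht => if_pos ht.2
  have hg2 : EqOn g (fun t => Φ.symm (u q + t • w)) (Icc T T') := fun t ht => by
    rcases eq_or_lt_of_le ht.1 with rfl | htT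
    · rw [hg1 hTm]
      change γ T = Φ.symm (u q + T • w)
      rw [← h.2 T hTm, hΦu hΦ]
      exact (Φ.left_inv hΦ).symm
    · exact if_neg (not_le.2 htT)
  have hun : Icc 0 T ∪ Icc T T' = Icc 0 T' := Icc_union_Icc_eq_Icc hT hT'.1.le
  refine ⟨g, ⟨?_, fun t ht => ?_⟩, by rw [hg1 ⟨le_rfl, hT⟩, h0]⟩
  · rw [← hun]
    exact (h.1.congr hg1).union_of_isClosed
      ((Φ.symm.contMDiffOn.continuousOn.comp hline.continuousOn hsub).congr hg2)
      isClosed_Icc isClosed_Icc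
  · rw [← hun] at ht
    rcases ht with ht | ht
    · rw [hg1 ht, h.2 t ht]
    · rw [hg2 ht]
      exact (hΦu (Φ.map_target (hsub t ht))).trans (Φ.right_inv (hsub t ht))

variable [RiemannianBundle (fun p : N => TangentSpace (𝓡 2) p)]

/-- A lift satisfies `du(γ') = w`, so expansion bounds its speed by `‖w‖`. -/
theorem LiftsLine.edist_le [IsRiemannianManifold (𝓡 2) N]
    (hu : IsLocalDiffeomorph (𝓡 2) (𝓡 2) ∞ u)
    (hexp : ∀ (p : N) (v : TangentSpace (𝓡 2) p),
      ‖v‖ ≤ ‖planeDeriv u p v‖)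
    {x w : EuclideanSpace ℝ (Fin 2)} {a b : ℝ} (hab : a ≤ b) {γ : ℝ → N}
    (h : LiftsLine u x w (Icc a b) γ) :
    edist (γ a) (γ b) ≤ ‖w‖₊ * edist a b := by
  rw [IsRiemannianManifold.out (I := 𝓡 2) (γ a) (γ b)]
  have hsm := h.contMDiffOn hu
  refine (Manifold.riemannianEDist_le_pathELength hsm rfl rfl hab).trans ?_
  rw [Manifold.pathELength_eq_lintegral_mfderiv_Ioo]
  have hb : ∀ t ∈ Ioo a b, ‖mfderiv 𝓘(ℝ, ℝ) (𝓡 2) γ t 1‖ₑ ≤ ‖w‖₊ := by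
    intro t ht
    have htn : Icc a b ∈ 𝓝 t := Icc_mem_nhds ht.1 ht.2
    have hd : MDifferentiableAt 𝓘(ℝ, ℝ) (𝓡 2) γ t :=
      (hsm.contMDiffAt htn).mdifferentiableAt one_ne_zero
    have h1 := ((hu (γ t)).contMDiffAt.mdifferentiableAt (by simp)).hasMFDerivAt.comp t
      hd.hasMFDerivAt
    have h2 : HasFDerivAt (fun t : ℝ => x + t • w)
        ((ContinuousLinearMap.id ℝ ℝ).smulRight w) t :=
      ((hasFDerivAt_id t).smul_const w).const_add x
    have h3 : HasMFDerivAt 𝓘(ℝ, ℝ) (𝓡 2) (u ∘ γ) t ((ContinuousLinearMap.id ℝ ℝ).smulRight w) :=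
      h2.hasMFDerivAt.congr_of_eventuallyEq (by filter_upwards [htn] with r hr using h.2 r hr)
    have h4 := DFunLike.congr_fun (hasMFDerivAt_unique h1 h3) (1 : ℝ)
    have h5 : planeDeriv u (γ t) (mfderiv 𝓘(ℝ, ℝ) (𝓡 2) γ t (1 : ℝ)) = w := by
      refine h4.trans ?_
      exact one_smul ℝ w
    have h6 := hexp (γ t) (mfderiv 𝓘(ℝ, ℝ) (𝓡 2) γ t (1 : ℝ))
    rw [h5] at h6
    exact enorm_le_coe.2 (NNReal.coe_le_coe.1 h6)
  calc ∫⁻ t in Ioo a b, ‖mfderiv 𝓘(ℝ, ℝ) (𝓡 2) γ t 1‖ₑ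
      ≤ ∫⁻ _ in Ioo a b, (‖w‖₊ : ℝ≥0∞) :=
        MeasureTheory.setLIntegral_mono measurable_const hb
    _ = ‖w‖₊ * edist a b := by
        rw [MeasureTheory.setLIntegral_const, Real.volume_Ioo, edist_comm, edist_dist,
          Real.dist_eq, abs_of_nonneg (sub_nonneg.2 hab)]

/-- A lift defined for all times `< T` extends to the time `T` if the surface is complete. -/
theorem LiftsLine.exists_Icc_of_forall_lt [IsRiemannianManifold (𝓡 2) N] [CompleteSpace N]
    (hu : IsLocalDiffeomorph (𝓡 2) (𝓡 2) ∞ u)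
    (hexp : ∀ (p : N) (v : TangentSpace (𝓡 2) p),
      ‖v‖ ≤ ‖planeDeriv u p v‖)
    {w : EuclideanSpace ℝ (Fin 2)} {q : N} {T : ℝ} (hT : 0 < T)
    (h : ∀ t ∈ Ico 0 T, ∃ γ : ℝ → N, LiftsLine u (u q) w (Icc 0 t) γ ∧ γ 0 = q) :
    ∃ γ : ℝ → N, LiftsLine u (u q) w (Icc 0 T) γ ∧ γ 0 = q := by
  have : Nonempty N := ⟨q⟩
  choose! γ hγ hγ0 using h
  have hagree : ∀ s ∈ Ico 0 T, ∀ t ∈ Ico 0 T, s ≤ t → EqOn (γ s) (γ t) (Icc 0 s) :=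
    fun s hs t ht hst => (hγ s hs).eqOn hu isPreconnected_Icc
      ((hγ t ht).mono (Icc_subset_Icc_right hst)) (left_mem_Icc.2 hs.1)
      ((hγ0 s hs).trans (hγ0 t ht).symm)
  -- Uniqueness of lifts makes the partial lifts agree, so the diagonal glues them; being Lipschitz,
  -- it has a limit at `T`.
  set g : ℝ → N := fun t => γ t t with hg
  have hgγ : ∀ t ∈ Ico 0 T, EqOn g (γ t) (Icc 0 t) := fun t ht s hs =>
    hagree s ⟨hs.1, hs.2.trans_lt ht.2⟩ t ht hs.2 ⟨hs.1, le_rfl⟩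
  have hglift : ∀ t ∈ Ico 0 T, LiftsLine u (u q) w (Icc 0 t) g := fun t ht =>
    ⟨(hγ t ht).1.congr (hgγ t ht), fun s hs => by rw [hgγ t ht hs, (hγ t ht).2 s hs]⟩
  have hlip : LipschitzOnWith ‖w‖₊ g (Ico 0 T) := by
    have key : ∀ s ∈ Ico 0 T, ∀ t ∈ Ico 0 T, s ≤ t → edist (g s) (g t) ≤ ‖w‖₊ * edist s t :=
      fun s hs t ht hst => ((hglift t ht).mono (Icc_subset_Icc_left hs.1)).edist_le hu hexp hst
    intro s hs t ht
    rcases le_total s t with hst | hst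
    · exact key s hs t ht hst
    · rw [edist_comm, edist_comm s]
      exact key t ht s hs hst
  have hfil : 𝓝[<] T ≤ 𝓟 (Ico 0 T) := le_principal_iff.2 (Ico_mem_nhdsLT hT)
  have hcauchy : Cauchy (map g (𝓝[<] T)) :=
    (cauchy_nhds.mono nhdsWithin_le_nhds).map_of_le hlip.uniformContinuousOn hfil
  obtain ⟨y, hy⟩ := CompleteSpace.complete hcauchy
  have hy' : Tendsto g (𝓝[<] T) (𝓝 y) := hy
  have hgI : ∀ t ∈ Ico 0 T, u (g t) = u q + t • w := fun t ht => (hglift t ht).2 t ⟨ht.1, le_rfl⟩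
  have huy : u y = u q + T • w := by
    have h1 : Tendsto (fun t => u (g t)) (𝓝[<] T) (𝓝 (u y)) :=
      (hu.contMDiff.continuous.tendsto y).comp hy'
    have h2 : Tendsto (fun t : ℝ => u q + t • w) (𝓝[<] T) (𝓝 (u q + T • w)) :=
      ((by fun_prop : Continuous fun t : ℝ => u q + t • w).tendsto T).mono_left
        nhdsWithin_le_nhds
    refine tendsto_nhds_unique (h1.congr' ?_) h2
    filter_upwards [hfil (mem_principal_self _)] with t ht using hgI t ht
  refine ⟨Function.update g T y, ⟨fun t ht => ?_, fun t ht => ?_⟩, ?_⟩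
  · rcases eq_or_lt_of_le ht.2 with rfl | htT
    · rw [continuousWithinAt_update_same]
      refine hy'.mono_left (nhdsWithin_mono _ ?_)
      exact fun s hs => lt_of_le_of_ne hs.1.2 hs.2
    · have h1 : ContinuousWithinAt g (Icc 0 T) t := by
        have h2 : ContinuousWithinAt g (Icc 0 ((t + T) / 2)) t :=
          (hglift ((t + T) / 2) ⟨by linarith [ht.1], by linarith⟩).1 t ⟨ht.1, by linarith⟩
        refine h2.mono_of_mem_nhdsWithin ?_
        filter_upwards [self_mem_nhdsWithin,
          mem_nhdsWithin_of_mem_nhds (Iic_mem_nhds (by linarith : t < (t + T) / 2))] with s hs hs'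
        exact ⟨hs.1, hs'⟩
      exact (continuousWithinAt_update_of_ne htT.ne).2 h1
  · rcases eq_or_lt_of_le ht.2 with rfl | htT
    · simpa using huy
    · rw [Function.update_of_ne htT.ne]
      exact hgI t ⟨ht.1, htT⟩
  · rw [Function.update_of_ne hT.ne]
    exact hγ0 0 ⟨le_rfl, hT⟩

/-- Continuity method: the times up to which a lift exists form a closed set by completeness, which
can be continued to the right by the local inverses. -/
theorem exists_liftsLine [IsRiemannianManifold (𝓡 2) N] [CompleteSpace N]
    (hu : IsLocalDiffeomorph (𝓡 2) (𝓡 2) ∞ u)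
    (hexp : ∀ (p : N) (v : TangentSpace (𝓡 2) p),
      ‖v‖ ≤ ‖planeDeriv u p v‖)
    (w : EuclideanSpace ℝ (Fin 2)) (q : N) :
    ∃ γ : ℝ → N, LiftsLine u (u q) w (Icc 0 1) γ ∧ γ 0 = q := by
  set S : Set ℝ := {T | ∃ γ : ℝ → N, LiftsLine u (u q) w (Icc 0 T) γ ∧ γ 0 = q} with hS
  have hdown : ∀ T ∈ S, ∀ T' ≤ T, T' ∈ S := fun T ⟨γ, h, h0⟩ T' hT =>
    ⟨γ, h.mono (Icc_subset_Icc_right hT), h0⟩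
  have h0 : (0 : ℝ) ∈ S :=
    ⟨fun _ => q, ⟨continuousOn_const, fun t ht => by
      have : t = 0 := le_antisymm ht.2 ht.1
      simp [this]⟩, rfl⟩
  have hclosed : IsClosed (S ∩ Icc 0 1) := by
    refine isClosed_of_closure_subset fun T hT => ?_
    have hT01 : T ∈ Icc (0 : ℝ) 1 :=
      isClosed_Icc.closure_subset_iff.2 inter_subset_right hT
    refine ⟨?_, hT01⟩
    rcases eq_or_lt_of_le hT01.1 with rfl | hTpos
    · exact h0
    refine LiftsLine.exists_Icc_of_forall_lt hu hexp hTpos fun t ht => ?_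
    obtain ⟨T', hT't, hT'⟩ := mem_closure_iff.1 hT (Ioi t) isOpen_Ioi ht.2
    exact hdown T' hT'.1 t (le_of_lt hT't)
  have := hclosed.Icc_subset_of_forall_mem_nhdsWithin h0 fun T hT => by
    obtain ⟨⟨γ, h, hγ⟩, hT01⟩ := hT
    exact h.eventually_exists hu hT01.1 hγ
  exact this ⟨zero_le_one, le_rfl⟩

/-- An expanding local diffeomorphism from a complete connected surface to the plane is
bijective. -/
theorem bijective_of_expanding [IsRiemannianManifold (𝓡 2) N] [CompleteSpace N] [ConnectedSpace N]
    (hu : IsLocalDiffeomorph (𝓡 2) (𝓡 2) ∞ u)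
    (hexp : ∀ (p : N) (v : TangentSpace (𝓡 2) p),
      ‖v‖ ≤ ‖planeDeriv u p v‖) :
    Function.Bijective u := by
  obtain ⟨q⟩ := (inferInstance : Nonempty N)
  choose γ hγ hγ0 using fun w => exists_liftsLine hu hexp w q
  let F : C(unitInterval × EuclideanSpace ℝ (Fin 2), EuclideanSpace ℝ (Fin 2)) :=
    ⟨fun z => u q + (z.1 : ℝ) • z.2, by fun_prop⟩
  -- Homotopy lifting: continuity of each path and of the initial points gives joint continuity.
  have hcont : Continuous fun z : unitInterval × EuclideanSpace ℝ (Fin 2) => γ z.2 z.1 := by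
    refine hu.isLocalHomeomorph.continuous_lift (T2Space.isSeparatedMap u) F ?_ ?_ ?_
    · funext z
      exact (hγ z.2).2 z.1 z.1.2
    · simp only [Icc.coe_zero, hγ0]
      exact continuous_const
    · intro w
      exact continuousOn_iff_continuous_domRestrict.1 (hγ w).1
  set s : EuclideanSpace ℝ (Fin 2) → N := fun x => γ (x - u q) 1 with hs
  have hsc : Continuous s := by
    have : Continuous fun x : EuclideanSpace ℝ (Fin 2) => ((1 : unitInterval), x - u q) := by fun_prop
    exact hcont.comp this
  have hus : ∀ x, u (s x) = x := fun x => by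
    rw [hs, (hγ _).2 1 ⟨zero_le_one, le_rfl⟩]; simp
  -- A continuous section of a local homeomorphism is open, and in a Hausdorff space its image is
  -- closed, as the set where `s ∘ u` agrees with the identity.
  have hopen : IsOpen (range s) := by
    refine (IsLocalHomeomorph.of_comp ?_ hu.isLocalHomeomorph hsc).isOpenMap.isOpen_range
    have : u ∘ s = id := funext hus
    rw [this]
    exact (Homeomorph.refl _).isLocalHomeomorph
  have hclosed : IsClosed (range s) := by
    have : range s = {y | s (u y) = y} := by
      ext y
      exact ⟨by rintro ⟨x, rfl⟩; simp only [mem_ofPred_eq, hus], fun h => ⟨_, h⟩⟩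
    rw [this]
    exact isClosed_eq (hsc.comp hu.contMDiff.continuous) continuous_id
  have huniv : range s = univ := IsClopen.eq_univ ⟨hclosed, hopen⟩ ⟨s 0, mem_range_self 0⟩
  refine ⟨fun a b hab => ?_, fun x => ⟨s x, hus x⟩⟩
  obtain ⟨x, rfl⟩ : a ∈ range s := huniv ▸ mem_univ a
  obtain ⟨y, rfl⟩ : b ∈ range s := huniv ▸ mem_univ b
  rw [hus, hus] at hab
  rw [hab]

end Expanding

/-! ### The projection to the hyperbolic plane -/

/-- The global chart of the hyperbolic plane is a diffeomorphism. -/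
noncomputable def Hyp2.diffeo : Hyp2 ≃ₘ^∞⟮𝓡 2, 𝓡 2⟯ EuclideanSpace ℝ (Fin 2) where
  toEquiv := Hyp2.chart.toEquiv
  contMDiff_toFun := fun y =>
    (contMDiffOn_chart (I := 𝓡 2) (n := ∞) (x := y)).contMDiffAt Filter.univ_mem
  contMDiff_invFun := fun u =>
    (contMDiffOn_chart_symm (I := 𝓡 2) (n := ∞) (x := Hyp2.chart.symm u)).contMDiffAt
      Filter.univ_mem

/-- The projection of `ℝ⁵₂` to the plane of the last two coordinates. -/
noncomputable def planeProj : R5 →L[ℝ] EuclideanSpace ℝ (Fin 2) :=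
  LinearMap.toContinuousLinearMap
    { toFun := fun z => !₂[z 3, z 4]
      map_add' := fun y z => by ext i; fin_cases i <;> simp
      map_smul' := fun c z => by ext i; fin_cases i <;> simp }

/-- The projection of `ℝ⁵₂` to `ℝ³₁` omitting the second and third coordinates. -/
noncomputable def spaceProj : R5 →L[ℝ] (Fin 3 → ℝ) :=
  LinearMap.toContinuousLinearMap
    { toFun := fun z => ![z 0, z 3, z 4]
      map_add' := fun y z => by ext i; fin_cases i <;> simp
      map_smul' := fun c z => by ext i; fin_cases i <;> simp }

theorem spaceProj_apply (z : R5) : spaceProj z = ![z 0, z 3, z 4] := rfl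

theorem planeProj_apply (z : R5) : planeProj z = !₂[z 3, z 4] := rfl

theorem form31_spaceProj {y z : R5} (hy : y 1 = y 2) (hz : z 1 = z 2) :
    form31 (spaceProj y) (spaceProj z) = form52 y z := by
  simp [form31, form52, spaceProj_apply, hy, hz]

/-- The two equal coordinates cancel and the first one contributes negatively; this is the source of
the expansion estimate. -/
theorem form52_self_le {z : R5} (hz : z 1 = z 2) : form52 z z ≤ ‖planeProj z‖ ^ 2 := by
  rw [EuclideanSpace.norm_sq_eq]
  simp [form52, planeProj_apply, hz]
  nlinarith [mul_self_nonneg (z 0)]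

theorem toVec_chart_symm_planeProj {z : R5} (hz : form52 z z = -1) (h12 : z 1 = z 2)
    (h0 : 0 < z 0) : (Hyp2.chart.symm (planeProj z)).toVec = spaceProj z := by
  have h : 1 + z 3 ^ 2 + z 4 ^ 2 = z 0 ^ 2 := by
    simp only [form52, h12] at hz; linarith
  change Hyp2.lift (planeProj z) = _
  simp [Hyp2.lift, planeProj_apply, spaceProj_apply, h, Real.sqrt_sq h0.le]

/-- A smooth function on an open subset of the plane agrees near any point with a smooth function
on the plane. -/
theorem exists_contDiff_eqOn_ball {l : EuclideanSpace ℝ (Fin 2) → ℝ}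
    {T : Set (EuclideanSpace ℝ (Fin 2))} (hT : IsOpen T) (hl : ∀ x ∈ T, ContDiffAt ℝ ∞ l x)
    {x₀ : EuclideanSpace ℝ (Fin 2)} (hx₀ : x₀ ∈ T) :
    ∃ r > 0, ∃ l' : EuclideanSpace ℝ (Fin 2) → ℝ, ContDiff ℝ ∞ l' ∧
      ∀ x ∈ Metric.ball x₀ r, l' x = l x := by
  obtain ⟨r, hr, hball⟩ := Metric.isOpen_iff.1 hT x₀ hx₀
  -- The cutoff is `1` within `r / 4` and its support, of radius `r / 2`, stays inside the ball
  -- contained in `T`.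
  let β : ContDiffBump x₀ := ⟨r / 4, r / 2, by positivity, by linarith⟩
  refine ⟨r / 4, by positivity, fun x => β x * l x, ?_, fun x hx => ?_⟩
  · refine contDiff_iff_contDiffAt.2 fun x => ?_
    by_cases hx : x ∈ T
    · exact β.contDiff.contDiffAt.mul (hl x hx)
    · have hx' : x ∉ tsupport β := fun h => hx (hball (by
        rw [β.tsupport_eq] at h
        exact Metric.closedBall_subset_ball (by change r / 2 < r; linarith) h))
      have : (fun x => β x * l x) =ᶠ[𝓝 x] fun _ => 0 := by
        filter_upwards [notMem_tsupport_iff_eventuallyEq.1 hx'] with y hy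
        rw [hy, Pi.zero_apply, zero_mul]
      exact contDiffAt_const.congr_of_eventuallyEq this
  · change β x * l x = l x
    rw [β.one_of_mem_closedBall (Metric.ball_subset_closedBall hx), one_mul]

/-- A zero of the first coordinate would make the scalar square a sum of two squares, never `-1`. -/
theorem coord_zero_pos_of_isPreconnected {N : Type*} [TopologicalSpace N] {g : N → R5} (hg : Continuous g) {s : Set N}
    (hs : IsPreconnected s) (h : ∀ q ∈ s, form52 (g q) (g q) = -1 ∧ g q 1 = g q 2) {p : N}
    (hp : p ∈ s) (hp0 : 0 < g p 0) : ∀ q ∈ s, 0 < g q 0 := by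
  intro q hq
  by_contra! hq0
  have hc : ContinuousOn (fun q => g q 0) s := ((continuous_apply 0).comp hg).continuousOn
  obtain ⟨x, hx, hx0⟩ := hs.intermediate_value hq hp hc ⟨hq0, hp0.le⟩
  obtain ⟨h1, h2⟩ := h x hx
  simp only [form52] at h1
  simp only at hx0
  rw [hx0, h2] at h1
  nlinarith [mul_self_nonneg (g x 3), mul_self_nonneg (g x 4)]

/-! ### The local form over the hyperbolic plane -/

section Surface

variable {N : Type*} [TopologicalSpace N] [ChartedSpace (EuclideanSpace ℝ (Fin 2)) N]
  {f : N → R5} {o : ∀ p : N, Orientation ℝ (TangentSpace (𝓡 2) p) (Fin 2)}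

theorem hasMFDerivAt_clm_comp {E : Type*} [NormedAddCommGroup E] [NormedSpace ℝ E]
    (hf : ContMDiff (𝓡 2) 𝓘(ℝ, R5) ∞ f) (L : R5 →L[ℝ] E) (q : N) :
    HasMFDerivAt (𝓡 2) 𝓘(ℝ, E) (fun q => L (f q)) q (L.comp (dmap f q)) :=
  L.hasMFDerivAt.comp q ((hf q).mdifferentiableAt (by simp)).hasMFDerivAt

/-- A partial diffeomorphism to the plane, restricted to the preimage of an open set, as a partial
diffeomorphism to the hyperbolic plane. -/
noncomputable def toHyp2 (Φ : PartialDiffeomorph (𝓡 2) (𝓡 2) N (EuclideanSpace ℝ (Fin 2)) ∞)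
    {B : Set (EuclideanSpace ℝ (Fin 2))} (hB : IsOpen B) :
    PartialDiffeomorph (𝓡 2) (𝓡 2) N Hyp2 ∞ where
  toFun q := Hyp2.diffeo.symm (Φ q)
  invFun y := Φ.symm (Hyp2.diffeo y)
  source := Φ.source ∩ Φ ⁻¹' B
  target := Hyp2.diffeo ⁻¹' (Φ.target ∩ B)
  map_source' q hq := by
    simp only [mem_preimage, Diffeomorph.apply_symm_apply]
    exact ⟨Φ.map_source hq.1, hq.2⟩
  map_target' y hy := ⟨Φ.map_target hy.1, by
    have : Φ (Φ.symm (Hyp2.diffeo y)) = Hyp2.diffeo y := Φ.right_inv hy.1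
    rw [mem_preimage, this]
    exact hy.2⟩
  left_inv' q hq := by
    rw [Diffeomorph.apply_symm_apply]
    exact Φ.left_inv hq.1
  right_inv' y hy := by
    have : Φ (Φ.symm (Hyp2.diffeo y)) = Hyp2.diffeo y := Φ.right_inv hy.1
    rw [this, Diffeomorph.symm_apply_apply]
  open_source := Φ.contMDiffOn.continuousOn.isOpen_inter_preimage Φ.open_source hB
  open_target := (Φ.open_target.inter hB).preimage Hyp2.diffeo.continuous
  contMDiffOn_toFun := Hyp2.diffeo.symm.contMDiff.comp_contMDiffOn
    (Φ.contMDiffOn.mono inter_subset_left)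
  contMDiffOn_invFun := Φ.symm.contMDiffOn.comp Hyp2.diffeo.contMDiff.contMDiffOn
    fun _ hy => hy.1

variable [RiemannianBundle (fun p : N => TangentSpace (𝓡 2) p)]

theorem norm_le_of_null {A : R5 ≃ₗ[ℝ] R5} (hA : IsLinearIsometry52 A)
    (hf : IsIsometricImmersion f) {q : N}
    (h : ∀ v, A.symm (dmap f q v) 1 = A.symm (dmap f q v) 2) (v : TangentSpace (𝓡 2) q) :
    ‖v‖ ≤ ‖planeProj (A.symm (dmap f q v))‖ := by
  refine abs_le_of_sq_le_sq' ?_ (norm_nonneg _) |>.2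
  rw [← real_inner_self_eq_norm_sq, ← hf.isometric, ← A.apply_symm_apply (dmap f q v), hA]
  simpa using form52_self_le (h v)

/-- The coordinates `(y₂, y₃)` of the projection of the surface to the hyperbolic plane. -/
noncomputable def planeMap (A : R5 ≃ₗ[ℝ] R5) (f : N → R5) (q : N) : EuclideanSpace ℝ (Fin 2) :=
  planeProj (A.symm (f q))

theorem hasMFDerivAt_planeMap (A : R5 ≃ₗ[ℝ] R5) (hf : IsIsometricImmersion f) (q : N) :
    HasMFDerivAt (𝓡 2) (𝓡 2) (planeMap A f) q
      ((planeProj.comp (A.symm.toContinuousLinearEquiv : R5 →L[ℝ] R5)).comp (dmap f q)) :=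
  hasMFDerivAt_clm_comp hf.smooth
    (planeProj.comp (A.symm.toContinuousLinearEquiv : R5 →L[ℝ] R5)) q

theorem contMDiff_symm_comp (A : R5 ≃ₗ[ℝ] R5) (hf : IsIsometricImmersion f) :
    ContMDiff (𝓡 2) 𝓘(ℝ, R5) ∞ fun q => A.symm (f q) :=
  (A.symm.toContinuousLinearEquiv : R5 →L[ℝ] R5).contMDiff.comp hf.smooth

theorem contMDiff_planeMap (A : R5 ≃ₗ[ℝ] R5) (hf : IsIsometricImmersion f) :
    ContMDiff (𝓡 2) (𝓡 2) ∞ (planeMap A f) :=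
  planeProj.contMDiff.comp (contMDiff_symm_comp A hf)

theorem norm_le_planeDeriv {A : R5 ≃ₗ[ℝ] R5} (hA : IsLinearIsometry52 A)
    (hf : IsIsometricImmersion f) {q : N}
    (h : ∀ v, A.symm (dmap f q v) 1 = A.symm (dmap f q v) 2) (v : TangentSpace (𝓡 2) q) :
    ‖v‖ ≤ ‖planeDeriv (planeMap A f) q v‖ := by
  have : planeDeriv (planeMap A f) q v = planeProj (A.symm (dmap f q v)) :=
    DFunLike.congr_fun (hasMFDerivAt_planeMap A hf q).mfderiv v
  rw [this]
  exact norm_le_of_null hA hf h v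

theorem planeDeriv_injective {A : R5 ≃ₗ[ℝ] R5} (hA : IsLinearIsometry52 A)
    (hf : IsIsometricImmersion f) {q : N}
    (h : ∀ v, A.symm (dmap f q v) 1 = A.symm (dmap f q v) 2) :
    Function.Injective (mfderiv (𝓡 2) (𝓡 2) (planeMap A f) q) := by
  change Function.Injective (planeDeriv (planeMap A f) q)
  refine (injective_iff_map_eq_zero _).2 fun v hv => ?_
  have := norm_le_planeDeriv hA hf h v
  rw [hv, norm_zero] at this
  exact norm_le_zero_iff.1 this

variable [IsManifold (𝓡 2) ∞ N]

/-- A surface which lies in the hyperplane `x₂ = x₃` after the isometry `A` is locally the image of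
some `iMap lam`. -/
theorem exists_local_form {A : R5 ≃ₗ[ℝ] R5} (hA : IsLinearIsometry52 A)
    (hf : IsIsometricImmersion f) {W : Set N} (hW : IsOpen W)
    (h12 : ∀ q ∈ W, A.symm (f q) 1 = A.symm (f q) 2 ∧
      ∀ v, A.symm (dmap f q v) 1 = A.symm (dmap f q v) 2)
    (h0 : ∀ q ∈ W, 0 < A.symm (f q) 0) {p : N} (hp : p ∈ W) :
    ∃ (ψ : PartialDiffeomorph (𝓡 2) (𝓡 2) N Hyp2 ∞) (lam : Hyp2 → ℝ),
      p ∈ ψ.source ∧ ContMDiff (𝓡 2) 𝓘(ℝ, ℝ) ∞ lam ∧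
      ∀ q ∈ ψ.source, f q = A (iMap lam (ψ q)) := by
  obtain ⟨Φ, hpΦ, hΦW, hΦ⟩ := exists_partialDiffeomorph hW (contMDiff_planeMap A hf)
    (fun q hq => planeDeriv_injective hA hf (h12 q hq).2) hp
  have hl : ∀ x ∈ Φ.target, ContDiffAt ℝ ∞ (fun x => A.symm (f (Φ.symm x)) 1) x := fun x hx => by
    have h1 : ContMDiffAt (𝓡 2) 𝓘(ℝ, R5) ∞ (fun x => A.symm (f (Φ.symm x))) x :=
      (contMDiff_symm_comp A hf).contMDiffAt.comp x
        (Φ.symm.contMDiffOn.contMDiffAt (Φ.open_target.mem_nhds hx))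
    exact (contDiff_apply ℝ ℝ (1 : Fin 5)).contDiffAt.comp x h1.contDiffAt
  -- `λ` has to be smooth on the whole hyperbolic plane, so the coordinate function is cut off and
  -- the chart shrunk to a ball where nothing changed.
  obtain ⟨r, hr, l, hls, hlr⟩ := exists_contDiff_eqOn_ball Φ.open_target hl (Φ.map_source hpΦ)
  refine ⟨toHyp2 Φ (B := Metric.ball (Φ p) r) Metric.isOpen_ball, fun y => l (Hyp2.diffeo y),
    ⟨hpΦ, Metric.mem_ball_self hr⟩, hls.contMDiff.comp Hyp2.diffeo.contMDiff, fun q hq => ?_⟩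
  have hqΦ : q ∈ Φ.source := hq.1
  have hqW := hΦW hqΦ
  rw [← A.symm_apply_eq]
  have hsym : Φ.symm (Φ q) = q := Φ.left_inv hqΦ
  have hlam : l (Φ q) = A.symm (f q) 1 := by
    rw [hlr _ hq.2, hsym]
  have hform : form52 (A.symm (f q)) (A.symm (f q)) = -1 := by
    rw [← hA, A.apply_symm_apply]; exact hf.mem q
  have hvec : (Hyp2.diffeo.symm (Φ q)).toVec = spaceProj (A.symm (f q)) := by
    rw [hΦ q hqΦ]
    exact toVec_chart_symm_planeProj hform (h12 q hqW).1 (h0 q hqW)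
  change A.symm (f q) = iMap _ (Hyp2.diffeo.symm (Φ q))
  rw [iMap, hvec, Diffeomorph.apply_symm_apply, hlam, spaceProj_apply]
  funext i
  fin_cases i
  · rfl
  · rfl
  · exact (h12 q hqW).1.symm
  · rfl
  · rfl

end Surface

/-! ### The complete case -/

section Complete

variable {N : Type*} [EMetricSpace N] [ChartedSpace (EuclideanSpace ℝ (Fin 2)) N]
  [IsManifold (𝓡 2) ∞ N] [RiemannianBundle (fun p : N => TangentSpace (𝓡 2) p)]
  [IsRiemannianManifold (𝓡 2) N] {f : N → R5}

/-- A complete connected surface which lies in the hyperplane `x₂ = x₃` after the isometry `A` is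
isometric to the hyperbolic plane. -/
theorem isometricToHyp2_of_complete [ConnectedSpace N] [CompleteSpace N] {A : R5 ≃ₗ[ℝ] R5}
    (hA : IsLinearIsometry52 A) (hf : IsIsometricImmersion f)
    (h12 : ∀ q, A.symm (f q) 1 = A.symm (f q) 2 ∧
      ∀ v, A.symm (dmap f q v) 1 = A.symm (dmap f q v) 2)
    (h0 : ∀ q, 0 < A.symm (f q) 0) : IsometricToHyp2 N := by
  have hloc : IsLocalDiffeomorph (𝓡 2) (𝓡 2) ∞ (planeMap A f) := fun p => by
    obtain ⟨Φ, hpΦ, -, hΦ⟩ := exists_partialDiffeomorph isOpen_univ (contMDiff_planeMap A hf)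
      (fun q _ => planeDeriv_injective hA hf (h12 q).2) (mem_univ p)
    exact ⟨Φ, hpΦ, fun q hq => (hΦ q hq).symm⟩
  have hbij := bijective_of_expanding hloc fun q v => norm_le_planeDeriv hA hf (h12 q).2 v
  let φ : N ≃ₘ^∞⟮𝓡 2, 𝓡 2⟯ Hyp2 := (hloc.diffeomorphOfBijective hbij).trans Hyp2.diffeo.symm
  have hφ : (fun q => (φ q).toVec) = fun q =>
      (spaceProj.comp (A.symm.toContinuousLinearEquiv : R5 →L[ℝ] R5)) (f q) := by
    funext q
    have hform : form52 (A.symm (f q)) (A.symm (f q)) = -1 := by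
      rw [← hA, A.apply_symm_apply]; exact hf.mem q
    exact toVec_chart_symm_planeProj hform (h12 q).1 (h0 q)
  refine ⟨φ, fun p v w => ?_⟩
  rw [hφ, (hasMFDerivAt_clm_comp hf.smooth _ p).mfderiv]
  change form31 (spaceProj (A.symm (dmap f p v))) (spaceProj (A.symm (dmap f p w))) = _
  rw [form31_spaceProj ((h12 p).2 v) ((h12 p).2 w), ← hA, A.apply_symm_apply, A.apply_symm_apply,
    hf.isometric]

end Complete

end PseudoHyp

open PseudoHyp
theorem mainTheorem8 {N : Type*} [EMetricSpace N] [ChartedSpace (EuclideanSpace ℝ (Fin 2)) N]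
    [IsManifold (𝓡 2) ∞ N]
    [RiemannianBundle (fun p : N => TangentSpace (𝓡 2) p)]
    [IsContMDiffRiemannianBundle (𝓡 2) ∞ (EuclideanSpace ℝ (Fin 2))
      (fun p : N => TangentSpace (𝓡 2) p)]
    [IsRiemannianManifold (𝓡 2) N]
    (o : ∀ p : N, Orientation ℝ (TangentSpace (𝓡 2) p) (Fin 2))
    (ho : IsSurfaceOrientation o)
    (f : N → R5) (hf : IsIsometricImmersion f) (hiso : IsPlusIsotropic f o) :
    (ConnectedSpace N → CompleteSpace N → IsometricToHyp2 N) ∧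
    (∀ p₀ : N, ∃ A : R5 ≃ₗ[ℝ] R5, IsLinearIsometry52 A ∧
      ∀ p ∈ connectedComponent p₀,
        ∃ (ψ : PartialDiffeomorph (𝓡 2) (𝓡 2) N Hyp2 ∞) (lam : Hyp2 → ℝ),
          p ∈ ψ.source ∧ ContMDiff (𝓡 2) 𝓘(ℝ, ℝ) ∞ lam ∧
          ∀ q ∈ ψ.source, f q = A (iMap lam (ψ q))) := by
  have key : ∀ p₀ : N, ∃ A : R5 ≃ₗ[ℝ] R5, IsLinearIsometry52 A ∧
      (∀ q ∈ connectedComponent p₀, A.symm (f q) 1 = A.symm (f q) 2 ∧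
        ∀ v, A.symm (dmap f q v) 1 = A.symm (dmap f q v) 2) ∧
      ∀ q ∈ connectedComponent p₀, 0 < A.symm (f q) 0 := fun p₀ => by
    obtain ⟨A, hA, hA0, h⟩ := exists_isometry_component ho hf hiso p₀
    refine ⟨A, hA, h, coord_zero_pos_of_isPreconnected (contMDiff_symm_comp A hf).continuous
      isPreconnected_connectedComponent (fun q hq => ⟨?_, (h q hq).1⟩) mem_connectedComponent
      (by rw [hA0]; exact one_pos)⟩
    rw [← hA, A.apply_symm_apply]
    exact hf.mem q
  refine ⟨fun hconn hcomp => ?_, fun p₀ => ?_⟩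
  · obtain ⟨p₀⟩ := hconn.toNonempty
    obtain ⟨A, hA, h12, h0⟩ := key p₀
    have huniv : ∀ q, q ∈ connectedComponent p₀ := fun q => by
      rw [PreconnectedSpace.connectedComponent_eq_univ]; exact mem_univ q
    exact isometricToHyp2_of_complete hA hf (fun q => h12 q (huniv q)) fun q => h0 q (huniv q)
  · obtain ⟨A, hA, h12, h0⟩ := key p₀
    -- Components of a manifold are open, so the local form applies with the component as the open
    -- set.
    have : LocallyConnectedSpace N :=
      ChartedSpace.locallyConnectedSpace (EuclideanSpace ℝ (Fin 2)) N
    exact ⟨A, hA, fun p hp => exists_local_form hA hf isOpen_connectedComponent h12 h0 hp⟩
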